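/- An $n$-qubit state is called $d$-sparse if exactly $d$ of its $2^n$ computational-basis amplitudes are non-zero. Elementary gates are arbitrary single-qubit unitary gates and CNOT gates, and the size of a circuit is the number of its elementary gates. A circuit $U$ on $n+m$ qubits prepares an $n$-qubit state $|\psi\rangle$ with $m$ ancillary qubits if $U|0\rangle^{\otimes n}|0\rangle^{\otimes m}=|\psi\rangle|0\rangle^{\otimes m}$. Logarithms are to base $2$. (1) There are absolute constants $c,C>0$ such that for all integers $n\ge 1$ and $1\le d\le 2^n$ with $nd\ge 2$: every $n$-qubit $d$-sparse state can be prepared, with some number $m$ of ancillary qubits, by a circuit of size at most $C\left(\frac{nd}{\log (nd)}+n\right)$; and there is an $n$-qubit $d$-sparse state such that every circuit that prepares it, with any number $m\ge 0$ of ancillary qubits, has size at least $c\left(\frac{nd}{\log (nd)}+n\right)$. That is, with an unlimited number of ancillary qubits the worst-case circuit size for preparing $n$-qubit $d$-sparse states is $\Theta\left(\frac{nd}{\log (nd)}+n\right)$. (2) If $d=\mathrm{poly}(n)$, this circuit size is $\Theta\left(\frac{nd}{\log n}+n\right)$ and is achieved without ancillary qubits. That is, for all $a\in\mathbb{R}$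 and $k\in\mathbb{N}$ there are constants $c,C>0$ such that for all integers $n\ge 2$ and $1\le d\le 2^n$ with $d\le a n^k$: every $n$-qubit $d$-sparse state can be prepared by a circuit of size at most $C\left(\frac{nd}{\log n}+n\right)$ without ancillary qubits ($m=0$); and there is an $n$-qubit $d$-sparse state such that every circuit that prepares it, with any number $m\ge 0$ of ancillary qubits, has size at least $c\left(\frac{nd}{\log n}+n\right)$. -/

import Mathlib

/-- Amplitude vectors of a register whose qubits are labelled by `Q`:
`ψ x` is the amplitude of the computational basis state `|x⟩`, where `x : Q → Bool`. -/
abbrev QState (Q : Type) : Type := (Q → Bool) → ℂ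

/-- `ψ` is a (normalized) `d`-sparse quantum state: exactly `d` of its amplitudes are non-zero. -/
def IsSparseState {Q : Type} [Fintype Q] [DecidableEq Q] (d : ℕ) (ψ : QState Q) : Prop :=
  ∑ x, ‖ψ x‖ ^ 2 = 1 ∧ {x | ψ x ≠ 0}.ncard = d

/-- The elementary gates on a register with qubits `Q`: an arbitrary one-qubit unitary applied to
one qubit, and the CNOT gate with given control and (different) target. -/
inductive ElemGate (Q : Type) : Type where
  | single (q : Q) (U : Matrix.unitaryGroup Bool ℂ) : ElemGate Q
  | cnot (control target : Q) (h : control ≠ target) : ElemGate Q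

/-- The action of an elementary gate on amplitude vectors. -/
def ElemGate.apply {Q : Type} [DecidableEq Q] : ElemGate Q → QState Q → QState Q
  | .single q U, ψ => fun x => ∑ b : Bool, (U : Matrix Bool Bool ℂ) (x q) b *
      ψ (Function.update x q b)
  | .cnot c t _, ψ => fun x => ψ (Function.update x t (xor (x t) (x c)))

/-- A quantum circuit is a finite sequence of elementary gates (the head of the list is applied
first); its size is the number of its gates. -/
abbrev QCircuit (Q : Type) : Type := List (ElemGate Q)

/-- The size of a circuit: the total count of elementary gates. -/
def QCircuit.size {Q : Type} (C : QCircuit Q) : ℕ := List.length C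

/-- The operator implemented by a circuit, acting on amplitude vectors. -/
def QCircuit.run {Q : Type} [DecidableEq Q] (C : QCircuit Q) (ψ : QState Q) : QState Q :=
  List.foldl (fun φ g => ElemGate.apply g φ) ψ C

/-- The state `|0…0⟩` of all qubits. -/
def zeroState (Q : Type) [Fintype Q] : QState Q :=
  fun x => if ∀ q, x q = false then 1 else 0

/-- The state `|ψ⟩|0⟩^{⊗m}`: `n` data qubits in state `ψ`, followed by `m` ancillas in `|0⟩`. -/
def withZeroAncillas {n : ℕ} (m : ℕ) (ψ : QState (Fin n)) : QState (Fin n ⊕ Fin m) :=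
  fun x => ψ (fun i => x (Sum.inl i)) * zeroState (Fin m) (fun j => x (Sum.inr j))

/-- The circuit `C` on `n` data and `m` ancillary qubits prepares `ψ`:
it maps `|0⟩^{⊗n}|0⟩^{⊗m}` to `|ψ⟩|0⟩^{⊗m}`. -/
def Prepares {n m : ℕ} (C : QCircuit (Fin n ⊕ Fin m)) (ψ : QState (Fin n)) : Prop :=
  C.run (zeroState (Fin n ⊕ Fin m)) = withZeroAncillas m ψ

/-! ### Circuits, their inverses, and classical reversible maps -/

section Circuits

set_option linter.unusedSectionVars false

variable {Q : Type} [DecidableEq Q]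

/-! Upper bounds. A state carried by `r` qubits costs `O(2 ^ r)` gates: uniformly controlled
rotations distribute the moduli one qubit at a time, and a diagonal unitary adds the phases
(`exists_circuit_of_zeroOff`). A `d`-sparse state is reduced to this case by a classical reversible
map that sends its `d` support strings to strings on about `log d` qubits: the image state is
prepared, then the map is undone (`exists_circuit_of_hasCircuit`). Moving the strings one at a time
costs `O(n)` each, and the logarithm is gained in two different ways.

Without ancillas, about `(log n) / 8` strings are moved together (`exists_hasCircuit_batch`). The
`t` sources and `t` targets form a bit matrix with at most `4 ^ t` distinct columns, so `O(n)` CNOT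
gates clear every qubit except one per column type, and the remaining permutation involves few
qubits. A whole batch costs `O(n)`. The space this needs is available when `d` is polynomial in `n`
and `n` is large; small `n` only affect the constant.

With ancillas and `d > n`, the register is cut into blocks of about `(log d) / 2` qubits, each block
encoded in unary (`exists_hasCircuit_encode`). A code word has a single 1 per block, so exchanging
two code words only requires inspecting two qubits per block (`exists_hasCircuit_swap_codes`). Each
string then costs `O(n / log d)`, and the encoding costs `O(n * √d)`.

Lower bounds. The term `n` holds because a state with non-zero amplitude at the all-ones string
forces every data qubit to be touched. For the other term, the amplitudes produced by `s` gates in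
fixed positions are polynomials in `4 * s` gate entries, and since at most `2 * s` ancillas are
touched, at most `(n + 2 * s + 1) ^ (2 * s)` placements matter. There is a family of at least `2 ^
(n * d)` sparse states whose amplitudes lie in a set of at most `d + 1` numbers
(`exists_sparse_family`). The members hit by one polynomial map are separated by linearly
independent polynomials of small degree, so there are at most `(d * (d * s) + 1) ^ (4 * s)` of them
(`card_le_of_eval_eq`). Comparing logarithms bounds `s` from below. -/

theorem QCircuit.run_nil (ψ : QState Q) : QCircuit.run [] ψ = ψ := rfl

theorem QCircuit.run_cons (g : ElemGate Q) (K : QCircuit Q) (ψ : QState Q) :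
    QCircuit.run (g :: K) ψ = QCircuit.run K (g.apply ψ) := rfl

theorem QCircuit.run_append (K L : QCircuit Q) (ψ : QState Q) :
    QCircuit.run (K ++ L) ψ = QCircuit.run L (QCircuit.run K ψ) := by
  simp [QCircuit.run, List.foldl_append]

/-- The gate undoing a given gate. -/
def ElemGate.inverse : ElemGate Q → ElemGate Q
  | .single q U => .single q U⁻¹
  | .cnot c t h => .cnot c t h

theorem ElemGate.apply_single (q : Q) (U : Matrix.unitaryGroup Bool ℂ) (ψ : QState Q)
    (x : Q → Bool) : (ElemGate.single q U).apply ψ x =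
      (U : Matrix Bool Bool ℂ) (x q) false * ψ (Function.update x q false) +
        (U : Matrix Bool Bool ℂ) (x q) true * ψ (Function.update x q true) := by
  simp [ElemGate.apply, add_comm]

theorem ElemGate.apply_cnot (c t : Q) (h : c ≠ t) (ψ : QState Q) (x : Q → Bool) :
    (ElemGate.cnot c t h).apply ψ x = ψ (Function.update x t (xor (x t) (x c))) := rfl

theorem apply_single_single (q : Q) (U V : Matrix.unitaryGroup Bool ℂ) (ψ : QState Q) :
    (ElemGate.single q V).apply ((ElemGate.single q U).apply ψ) =
      (ElemGate.single q (V * U)).apply ψ := by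
  funext x
  simp only [ElemGate.apply_single, Function.update_self, Function.update_idem,
    Submonoid.coe_mul, Matrix.mul_apply, Fintype.sum_bool]
  ring

theorem apply_single_one (q : Q) (ψ : QState Q) :
    (ElemGate.single q 1).apply ψ = ψ := by
  funext x
  rw [ElemGate.apply_single]
  cases h : x q <;> simp [← h]

theorem ElemGate.apply_inverse_apply (g : ElemGate Q) (ψ : QState Q) :
    g.inverse.apply (g.apply ψ) = ψ := by
  cases g with
  | single q U =>
    rw [ElemGate.inverse, apply_single_single, inv_mul_cancel, apply_single_one]
  | cnot c t h =>
    funext x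
    simp [ElemGate.inverse, ElemGate.apply_cnot, Function.update_of_ne h]

theorem ElemGate.apply_apply_inverse (g : ElemGate Q) (ψ : QState Q) :
    g.apply (g.inverse.apply ψ) = ψ := by
  cases g with
  | single q U =>
    rw [ElemGate.inverse, apply_single_single, mul_inv_cancel, apply_single_one]
  | cnot c t h =>
    funext x
    simp [ElemGate.inverse, ElemGate.apply_cnot, Function.update_of_ne h]

/-- The circuit undoing a given circuit. -/
def QCircuit.inverse (K : QCircuit Q) : QCircuit Q := (K.map ElemGate.inverse).reverse

theorem QCircuit.length_inverse (K : QCircuit Q) : K.inverse.length = K.length := by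
  simp [QCircuit.inverse]

theorem QCircuit.run_inverse_run (K : QCircuit Q) (ψ : QState Q) :
    K.inverse.run (K.run ψ) = ψ := by
  induction K generalizing ψ with
  | nil => rfl
  | cons g K ih =>
    have : QCircuit.inverse (g :: K) = QCircuit.inverse K ++ [g.inverse] := by
      simp [QCircuit.inverse]
    rw [this, QCircuit.run_append, QCircuit.run_cons, QCircuit.run_cons, ih, QCircuit.run_nil,
      ElemGate.apply_inverse_apply]

theorem QCircuit.run_run_inverse (K : QCircuit Q) (ψ : QState Q) :
    K.run (K.inverse.run ψ) = ψ := by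
  induction K generalizing ψ with
  | nil => rfl
  | cons g K ih =>
    have : QCircuit.inverse (g :: K) = QCircuit.inverse K ++ [g.inverse] := by
      simp [QCircuit.inverse]
    rw [this, QCircuit.run_append, QCircuit.run_cons, QCircuit.run_cons, QCircuit.run_nil,
      ElemGate.apply_apply_inverse, ih]

/-- The operator `A` is implemented by a circuit with at most `s` gates. -/
def Realizes (A : QState Q → QState Q) (s : ℕ) : Prop :=
  ∃ K : QCircuit Q, K.length ≤ s ∧ ∀ ψ, K.run ψ = A ψ

theorem Realizes.mono {A : QState Q → QState Q} {s s' : ℕ} (h : Realizes A s) (hs : s ≤ s') :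
    Realizes A s' := by
  obtain ⟨K, hK, h⟩ := h
  exact ⟨K, hK.trans hs, h⟩

theorem Realizes.comp {A A' : QState Q → QState Q} {s s' : ℕ} (h' : Realizes A' s')
    (h : Realizes A s) : Realizes (A' ∘ A) (s + s') := by
  obtain ⟨K, hK, h⟩ := h
  obtain ⟨K', hK', h'⟩ := h'
  refine ⟨K ++ K', by simp; omega, fun ψ => ?_⟩
  rw [QCircuit.run_append, h, h', Function.comp]

theorem Realizes.of_gate (g : ElemGate Q) : Realizes g.apply 1 :=
  ⟨[g], by simp, fun _ => rfl⟩

/-- The map `f` on bit strings is implemented by a circuit with at most `s` gates: the circuit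
turns the amplitude vector `ψ` into `ψ ∘ f`. -/
def HasCircuit (f : (Q → Bool) → (Q → Bool)) (s : ℕ) : Prop :=
  Realizes (fun ψ => ψ ∘ f) s

theorem HasCircuit.mono {f : (Q → Bool) → (Q → Bool)} {s s' : ℕ} (h : HasCircuit f s)
    (hs : s ≤ s') : HasCircuit f s' := Realizes.mono h hs

theorem HasCircuit.comp {f g : (Q → Bool) → (Q → Bool)} {s s' : ℕ} (hf : HasCircuit f s)
    (hg : HasCircuit g s') : HasCircuit (f ∘ g) (s + s') :=
  Realizes.comp hg hf

theorem HasCircuit.id : HasCircuit (fun x : Q → Bool => x) 0 := ⟨[], by simp, fun _ => rfl⟩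

/-- A circuit is invertible, so every amplitude vector has the form `ψ ∘ f`. If `f` identified two
strings, the point mass at one of them would not be of this form. -/
theorem HasCircuit.injective {f : (Q → Bool) → (Q → Bool)} {s : ℕ} (hf : HasCircuit f s) :
    Function.Injective f := by
  classical
  obtain ⟨K, -, hK⟩ := hf
  intro x y hxy
  by_contra hne
  have h := K.run_run_inverse (fun z => if z = x then (1 : ℂ) else 0)
  rw [hK] at h
  have h1 := congrFun h x
  have h2 := congrFun h y
  simp only [Function.comp, hxy] at h1 h2
  rw [h1] at h2
  simp [Ne.symm hne] at h2

theorem HasCircuit.exists_inverse [Fintype Q] {f : (Q → Bool) → (Q → Bool)} {s : ℕ}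
    (hf : HasCircuit f s) :
    ∃ g, HasCircuit g s ∧ (∀ x, g (f x) = x) ∧ ∀ x, f (g x) = x := by
  have hb : Function.Bijective f := Finite.injective_iff_bijective.1 hf.injective
  let e := Equiv.ofBijective f hb
  refine ⟨e.symm, ?_, fun x => e.symm_apply_apply x, fun x => e.apply_symm_apply x⟩
  obtain ⟨K, hs, hK⟩ := hf
  refine ⟨K.inverse, by rwa [K.length_inverse], fun ψ => ?_⟩
  have h := K.run_inverse_run (ψ ∘ e.symm)
  rw [hK] at h
  have : (ψ ∘ e.symm) ∘ f = ψ := by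
    funext x
    exact congrArg ψ (e.symm_apply_apply x)
  exact (congrArg K.inverse.run this.symm).trans h

/-- Flip the bit `t` of `x` if `p x` holds. -/
def flipBit (t : Q) (p : (Q → Bool) → Bool) (x : Q → Bool) : Q → Bool :=
  Function.update x t (xor (x t) (p x))

theorem flipBit_self (t : Q) (p : (Q → Bool) → Bool) (x : Q → Bool) :
    flipBit t p x t = xor (x t) (p x) := by simp [flipBit]

theorem flipBit_of_ne {t j : Q} (h : j ≠ t) (p : (Q → Bool) → Bool) (x : Q → Bool) :
    flipBit t p x j = x j := by simp [flipBit, h]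

theorem hasCircuit_cnot {c t : Q} (h : c ≠ t) : HasCircuit (flipBit t fun x => x c) 1 :=
  Realizes.of_gate (.cnot c t h)

/-- The unitary matrix exchanging the two basis states. -/
def notGate : Matrix.unitaryGroup Bool ℂ :=
  ⟨Matrix.of fun i j => if i = j then 0 else 1, by
    rw [Matrix.mem_unitaryGroup_iff]
    ext i j
    cases i <;> cases j <;> simp [Matrix.mul_apply, Matrix.star_apply]⟩

theorem hasCircuit_not (t : Q) : HasCircuit (flipBit t fun _ => true) 1 := by
  refine ⟨[.single t notGate], by simp, fun ψ => ?_⟩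
  funext x
  rw [QCircuit.run_cons, QCircuit.run_nil, ElemGate.apply_single]
  cases h : x t <;> simp [notGate, flipBit, h]

/-- Two conditional flips of the same bit amount to one. -/
theorem HasCircuit.flipBit_xor {t : Q} {p p' : (Q → Bool) → Bool} {s s' : ℕ}
    (h : HasCircuit (flipBit t p) s) (h' : HasCircuit (flipBit t p') s')
    (hp : ∀ x b, p (Function.update x t b) = p x) :
    HasCircuit (flipBit t fun x => xor (p x) (p' x)) (s + s') := by
  convert h.comp h' using 1
  funext x j
  by_cases hj : j = t
  · subst hj
    simp only [Function.comp, flipBit_self]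
    simp only [flipBit, hp]
    cases x j <;> cases p x <;> cases p' x <;> rfl
  · simp [Function.comp, flipBit_of_ne hj]

/-- Flip each bit `j ∈ J` of `x` for which `p j x` holds. -/
def flipBits (J : Finset Q) (p : Q → (Q → Bool) → Bool) (x : Q → Bool) : Q → Bool :=
  fun j => if j ∈ J then xor (x j) (p j x) else x j

/-- Since the conditions read only bits outside `J`, no flip affects the condition of another, and
the flips can be done one after the other. -/
theorem hasCircuit_flipBits {J : Finset Q} {p : Q → (Q → Bool) → Bool} {s : ℕ}
    (h : ∀ j ∈ J, HasCircuit (flipBit j (p j)) s)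
    (hp : ∀ j ∈ J, ∀ x y : Q → Bool, (∀ i, i ∉ J → x i = y i) → p j x = p j y) :
    HasCircuit (flipBits J p) (J.card * s) := by
  suffices H : ∀ I ⊆ J, HasCircuit (flipBits I p) (I.card * s) from H J subset_rfl
  intro I
  induction I using Finset.induction with
  | empty =>
    intro _
    exact (HasCircuit.id (Q := Q)).mono (by simp)
  | insert a I ha ih =>
    intro hI
    have haJ := hI (Finset.mem_insert_self a I)
    have hIJ := (Finset.insert_subset_iff.1 hI).2
    have := (h a haJ).comp (ih hIJ)
    rw [Finset.card_insert_of_notMem ha, add_mul, one_mul, add_comm]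
    convert this using 1
    funext x j
    have hpa : p a (flipBits I p x) = p a x := by
      refine hp a haJ _ _ fun i hi => ?_
      simp [flipBits, show i ∉ I from fun h => hi (hIJ h)]
    by_cases hj : j = a
    · subst hj
      simp only [Function.comp, flipBit_self, hpa]
      simp [flipBits, ha]
    · simp only [Function.comp, flipBit_of_ne hj]
      simp [flipBits, hj]

theorem flipBits_flipBits {J : Finset Q} {p : Q → (Q → Bool) → Bool}
    (hp : ∀ j ∈ J, ∀ x y : Q → Bool, (∀ i, i ∉ J → x i = y i) → p j x = p j y)
    (x : Q → Bool) : flipBits J p (flipBits J p x) = x := by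
  funext j
  by_cases hj : j ∈ J
  · have : p j (flipBits J p x) = p j x :=
      hp j hj _ _ fun i hi => by simp [flipBits, hi]
    rw [flipBits, if_pos hj, this]
    simp [flipBits, hj]
  · simp [flipBits, hj]

/-- Flipping a bit by the parity of a set of other bits. -/
theorem hasCircuit_flipBit_sum {ι : Type} [DecidableEq ι] (I : Finset ι) (c : ι → Q) {t : Q}
    (hc : ∀ i ∈ I, c i ≠ t) (v : (Q → Bool) → Bool)
    (hv : ∀ x, v x = decide (Odd (I.filter fun i => x (c i) = true).card)) :
    HasCircuit (flipBit t v) I.card := by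
  induction I using Finset.induction generalizing v with
  | empty =>
    convert (HasCircuit.id (Q := Q)).mono (Nat.zero_le _) using 1
    funext x
    simp [flipBit, hv]
  | insert a I ha ih =>
    have h1 := ih (fun i hi => hc i (Finset.mem_insert_of_mem hi)) _ fun _ => rfl
    have h2 := hasCircuit_cnot (hc a (Finset.mem_insert_self a I))
    rw [Finset.card_insert_of_notMem ha, add_comm]
    convert h2.flipBit_xor h1 ?_ using 2
    · funext x
      rw [hv, Finset.filter_insert]
      by_cases hx : x (c a) = true
      · rw [if_pos hx, Finset.card_insert_of_notMem (by simp [ha])]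
        by_cases ho : Odd (I.filter fun i => x (c i) = true).card
        · simp [hx, ho, Nat.odd_add_one]
        · simp [hx, ho, Nat.odd_add_one]
      · rw [if_neg hx]
        simp only [Bool.not_eq_true] at hx
        simp [hx]
    · intro x b
      rw [Function.update_of_ne (hc a (Finset.mem_insert_self a I))]

/-- The gate on the relabelled register. -/
def ElemGate.relabel {Q' : Type} (e : Q ≃ Q') : ElemGate Q → ElemGate Q'
  | .single q U => .single (e q) U
  | .cnot c t h => .cnot (e c) (e t) (e.injective.ne h)

theorem ElemGate.apply_relabel {Q' : Type} [DecidableEq Q'] (e : Q ≃ Q') (g : ElemGate Q)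
    (ψ : QState Q) :
    (g.relabel e).apply (fun y => ψ (y ∘ e)) = fun y => g.apply ψ (y ∘ e) := by
  funext y
  have h : ∀ q b, Function.update y (e q) b ∘ e = Function.update (y ∘ e) q b := by
    intro q b
    funext j
    by_cases hj : j = q
    · subst hj; simp
    · simp [hj]
  cases g with
  | single q U => simp [ElemGate.relabel, ElemGate.apply_single, h]
  | cnot c t hne => simp [ElemGate.relabel, ElemGate.apply_cnot, h]

theorem QCircuit.run_relabel {Q' : Type} [DecidableEq Q'] (e : Q ≃ Q') (K : QCircuit Q)
    (ψ : QState Q) :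
    QCircuit.run (K.map (ElemGate.relabel e)) (fun y => ψ (y ∘ e)) =
      fun y => K.run ψ (y ∘ e) := by
  induction K generalizing ψ with
  | nil => rfl
  | cons g K ih =>
    rw [List.map_cons, QCircuit.run_cons, ElemGate.apply_relabel, ih]
    rfl

end Circuits

/-! ### Uniformly controlled gates, diagonal unitaries and the Toffoli gate -/

section Rotations

variable {Q : Type} [DecidableEq Q]

set_option linter.unusedSectionVars false

/-- `θ x` only depends on the bits of `x` in the list `R`. -/
def DependsOnBits {α : Type} (R : List Q) (θ : (Q → Bool) → α) : Prop :=
  ∀ x y, (∀ c ∈ R, x c = y c) → θ x = θ y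

/-- The uniformly controlled gate applying `G (θ x)` to the qubit `q`. -/
def controlledGate (G : ℝ → Matrix.unitaryGroup Bool ℂ) (q : Q) (θ : (Q → Bool) → ℝ)
    (ψ : QState Q) : QState Q := fun x =>
  (G (θ x) : Matrix Bool Bool ℂ) (x q) false * ψ (Function.update x q false) +
    (G (θ x) : Matrix Bool Bool ℂ) (x q) true * ψ (Function.update x q true)

/-- Induction on the controls. Let `a` and `b` be the half-sum and half-difference of the angles for
the two values of the control `c`. Conjugating `G b` by CNOT from `c` to `q` turns `b` into `-b`
exactly when `c` is set, by `hneg`, so the product with `G a` has angle `a + b` or `a - b`, as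
needed. The size obeys `f (k + 1) = 2 * f k + 2` with `f 0 = 1`. -/
theorem realizes_controlledGate {G : ℝ → Matrix.unitaryGroup Bool ℂ}
    (hadd : ∀ a b, G (a + b) = G a * G b)
    (hneg : ∀ a i j, (G (-a) : Matrix Bool Bool ℂ) i j = (G a : Matrix Bool Bool ℂ) (!i) (!j))
    (q : Q) (R : List Q) (hq : q ∉ R) (θ : (Q → Bool) → ℝ) (hθ : DependsOnBits R θ) :
    Realizes (controlledGate G q θ) (3 * 2 ^ R.length - 2) := by
  induction R generalizing θ with
  | nil =>
    refine ⟨[.single q (G (θ fun _ => false))], by simp, fun ψ => ?_⟩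
    funext x
    have : θ x = θ fun _ => false := hθ _ _ (by simp)
    simp only [QCircuit.run_cons, QCircuit.run_nil, ElemGate.apply_single, controlledGate, this]
  | cons c R ih =>
    simp only [List.mem_cons, not_or] at hq
    obtain ⟨hqc, hqR⟩ := hq
    have hdep : ∀ b x y, (∀ i ∈ R, x i = y i) →
        θ (Function.update x c b) = θ (Function.update y c b) := by
      intro b x y hxy
      refine hθ _ _ fun i hi => ?_
      by_cases hic : i = c
      · subst hic; simp
      · simpa [hic] using hxy i ((List.mem_cons.1 hi).resolve_left hic)
    let a : (Q → Bool) → ℝ := fun x =>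
      (θ (Function.update x c false) + θ (Function.update x c true)) / 2
    let b : (Q → Bool) → ℝ := fun x =>
      (θ (Function.update x c false) - θ (Function.update x c true)) / 2
    have ha : DependsOnBits R a := fun x y h => by
      simp only [a]; rw [hdep false x y h, hdep true x y h]
    have hb : DependsOnBits R b := fun x y h => by
      simp only [b]; rw [hdep false x y h, hdep true x y h]
    have hc := hasCircuit_cnot (c := c) (t := q) (Ne.symm hqc)
    have hpow : 1 ≤ 2 ^ R.length := Nat.one_le_two_pow
    refine Realizes.mono (?_ : Realizes _ _) (show 3 * 2 ^ R.length - 2 + 1 +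
      (3 * 2 ^ R.length - 2) + 1 ≤ 3 * 2 ^ (c :: R).length - 2 by
        rw [List.length_cons, pow_succ]; omega)
    convert Realizes.comp hc ((ih hqR b hb).comp (Realizes.comp hc (ih hqR a ha))) using 1
    funext ψ x
    have haq : ∀ x v, a (Function.update x q v) = a x := fun x v =>
      ha _ _ fun i hi => Function.update_of_ne (fun h : i = q => hqR (h ▸ hi)) _ _
    have hbq : ∀ x v, b (Function.update x q v) = b x := fun x v =>
      hb _ _ fun i hi => Function.update_of_ne (fun h : i = q => hqR (h ▸ hi)) _ _
    simp only [Function.comp, controlledGate, flipBit, Function.update_self,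
      Function.update_idem, Function.update_of_ne (Ne.symm hqc), haq, hbq]
    have key : θ x = (if x c then - b x else b x) + a x := by
      have : Function.update x c (x c) = x := Function.update_eq_self c x
      cases hxc : x c
      · rw [hxc] at this; simp only [a, b, this]; simp; ring
      · rw [hxc] at this; simp only [a, b, this]; simp; ring
    rw [key, hadd]
    simp only [Submonoid.coe_mul, Matrix.mul_apply, Fintype.sum_bool]
    cases hxc : x c
    · simp
      ring
    · simp only [if_true, hneg]
      cases x q <;> simp <;> ring

/-- The real rotation by the angle `θ`. -/
noncomputable def rotationGate (θ : ℝ) : Matrix.unitaryGroup Bool ℂ :=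
  ⟨Matrix.of fun i j => if i = j then (Real.cos θ : ℂ) else
      if i then (Real.sin θ : ℂ) else -(Real.sin θ : ℂ), by
    have h : (Real.cos θ : ℂ) * Real.cos θ + Real.sin θ * Real.sin θ = 1 := by
      have := Real.cos_sq_add_sin_sq θ
      rw [sq, sq] at this
      exact_mod_cast this
    rw [Matrix.mem_unitaryGroup_iff]
    ext i j
    rw [Matrix.mul_apply]
    cases i <;> cases j <;>
      simp only [Fintype.sum_bool, Matrix.star_apply, Matrix.of_apply, Matrix.one_apply] <;>
      simp [Complex.conj_ofReal, -Complex.ofReal_cos, -Complex.ofReal_sin] <;>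
      first | ring1 | linear_combination h⟩

/-- The diagonal gate with phases `-θ` and `θ`. -/
noncomputable def phaseGate (θ : ℝ) : Matrix.unitaryGroup Bool ℂ :=
  ⟨Matrix.of fun i j => if i = j then Complex.exp ((if i then θ else -θ : ℝ) * Complex.I)
      else 0, by
    rw [Matrix.mem_unitaryGroup_iff]
    ext i j
    rw [Matrix.mul_apply]
    cases i <;> cases j <;>
      simp [← Complex.exp_conj, ← Complex.exp_add]⟩

theorem rotationGate_add (a b : ℝ) : rotationGate (a + b) = rotationGate a * rotationGate b := by
  ext i j
  rw [Submonoid.coe_mul, Matrix.mul_apply]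
  cases i <;> cases j <;>
    simp [rotationGate, Complex.cos_add, Complex.sin_add] <;> ring

theorem rotationGate_neg (a : ℝ) (i j : Bool) : (rotationGate (-a) : Matrix Bool Bool ℂ) i j =
    (rotationGate a : Matrix Bool Bool ℂ) (!i) (!j) := by
  cases i <;> cases j <;> simp [rotationGate]

theorem phaseGate_add (a b : ℝ) : phaseGate (a + b) = phaseGate a * phaseGate b := by
  ext i j
  rw [Submonoid.coe_mul, Matrix.mul_apply]
  cases i <;> cases j <;> simp [phaseGate, ← Complex.exp_add] <;> ring_nf

theorem phaseGate_neg (a : ℝ) (i j : Bool) : (phaseGate (-a) : Matrix Bool Bool ℂ) i j =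
    (phaseGate a : Matrix Bool Bool ℂ) (!i) (!j) := by
  cases i <;> cases j <;> simp [phaseGate]

/-- Multiplication of all amplitudes by the phase `θ`. -/
noncomputable def scalarGate (θ : ℝ) : Matrix.unitaryGroup Bool ℂ :=
  ⟨Matrix.of fun i j => if i = j then Complex.exp (θ * Complex.I) else 0, by
    rw [Matrix.mem_unitaryGroup_iff]
    ext i j
    rw [Matrix.mul_apply]
    cases i <;> cases j <;>
      simp [← Complex.exp_conj, ← Complex.exp_add]⟩

/-- Diagonal unitaries on few qubits. -/
theorem realizes_diagonal [Nonempty Q] (R : List Q) (hR : R.Nodup) (θ : (Q → Bool) → ℝ)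
    (hθ : DependsOnBits R θ) :
    Realizes (fun ψ x => Complex.exp (θ x * Complex.I) * ψ x) (3 * 2 ^ R.length) := by
  induction R generalizing θ with
  | nil =>
    -- A global phase still has to be a gate on some qubit, hence the nonempty register.
    let q : Q := Classical.arbitrary Q
    refine ⟨[.single q (scalarGate (θ fun _ => false))], by simp, fun ψ => ?_⟩
    funext x
    have : θ x = θ fun _ => false := hθ _ _ (by simp)
    rw [QCircuit.run_cons, QCircuit.run_nil, ElemGate.apply_single, ← this]
    cases h : x q <;> simp [scalarGate, ← h]
  | cons q R ih =>
    obtain ⟨hqR, hR⟩ := List.nodup_cons.1 hR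
    have hdep : ∀ b x y, (∀ i ∈ R, x i = y i) →
        θ (Function.update x q b) = θ (Function.update y q b) := by
      intro b x y hxy
      refine hθ _ _ fun i hi => ?_
      by_cases hic : i = q
      · subst hic; simp
      · simpa [hic] using hxy i ((List.mem_cons.1 hi).resolve_left hic)
    -- The mean over the bit `q` is a phase in the remaining bits; the half-difference is a
    -- controlled `phaseGate` on `q`.
    let a : (Q → Bool) → ℝ := fun x =>
      (θ (Function.update x q true) + θ (Function.update x q false)) / 2
    let b : (Q → Bool) → ℝ := fun x =>
      (θ (Function.update x q true) - θ (Function.update x q false)) / 2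
    have ha : DependsOnBits R a := fun x y h => by
      simp only [a]; rw [hdep false x y h, hdep true x y h]
    have hb : DependsOnBits R b := fun x y h => by
      simp only [b]; rw [hdep false x y h, hdep true x y h]
    refine Realizes.mono (?_ : Realizes _ _) (show 3 * 2 ^ R.length + (3 * 2 ^ R.length - 2)
      ≤ 3 * 2 ^ (q :: R).length by rw [List.length_cons, pow_succ]; omega)
    convert (realizes_controlledGate phaseGate_add phaseGate_neg q R hqR b hb).comp
      (ih hR a ha) using 1
    funext ψ x
    have haq : ∀ x v, a (Function.update x q v) = a x := fun x v =>
      ha _ _ fun i hi => Function.update_of_ne (fun h : i = q => hqR (h ▸ hi)) _ _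
    have hu : Function.update x q (x q) = x := Function.update_eq_self q x
    simp only [Function.comp, controlledGate, haq]
    cases hx : x q
    · rw [hx] at hu
      have : θ x = -b x + a x := by simp only [a, b, hu]; ring
      rw [this]
      simp [phaseGate, hu, add_mul, Complex.exp_add, mul_assoc]
    · rw [hx] at hu
      have : θ x = b x + a x := by simp only [a, b, hu]; ring
      rw [this]
      simp [phaseGate, hu, add_mul, Complex.exp_add, mul_assoc]

/-- The Hadamard gate. -/
noncomputable def hadamardGate : Matrix.unitaryGroup Bool ℂ :=
  ⟨Matrix.of fun i j => ((√2 : ℝ) : ℂ)⁻¹ * if i && j then -1 else 1, by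
    have h : ((√2 : ℝ) : ℂ) * ((√2 : ℝ) : ℂ) = 2 := by
      have := Real.mul_self_sqrt (show (0 : ℝ) ≤ 2 by norm_num)
      exact_mod_cast this
    have h' : (((√2 : ℝ) : ℂ))⁻¹ * (((√2 : ℝ) : ℂ))⁻¹ = 1 / 2 := by
      rw [← mul_inv, h, one_div]
    rw [Matrix.mem_unitaryGroup_iff]
    ext i j
    rw [Matrix.mul_apply]
    cases i <;> cases j <;>
      (simp [Complex.conj_ofReal, h']; try norm_num)⟩

/-- Conjugating the doubly controlled sign, a diagonal unitary on three qubits, by Hadamard gates on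
the target gives the Toffoli gate: `1 + 3 * 2 ^ 3 + 1 = 26` gates. -/
theorem hasCircuit_toffoli {a b t : Q} (hab : a ≠ b) (hat : a ≠ t) (hbt : b ≠ t) :
    HasCircuit (flipBit t fun x => x a && x b) 26 := by
  have : Nonempty Q := ⟨a⟩
  have hd := realizes_diagonal [a, b, t] (by simp [hab, hat, hbt])
    (fun x => if x a && x b && x t then Real.pi else 0) (by
      intro x y h
      simp [h a (by simp), h b (by simp), h t (by simp)])
  have hh : Realizes (ElemGate.single t hadamardGate).apply 1 := Realizes.of_gate _
  refine Realizes.mono (?_ : Realizes _ _) (show 1 + 3 * 2 ^ [a, b, t].length + 1 ≤ 26 by simp)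
  convert hh.comp (hd.comp hh) using 1
  have h : ((√2 : ℝ) : ℂ) * ((√2 : ℝ) : ℂ) = 2 := by
    have := Real.mul_self_sqrt (show (0 : ℝ) ≤ 2 by norm_num)
    exact_mod_cast this
  have h2 : (((√2 : ℝ) : ℂ) ^ 2)⁻¹ = 1 / 2 := by rw [pow_two, h, one_div]
  funext ψ x
  have hu : Function.update x t (x t) = x := Function.update_eq_self t x
  simp only [Function.comp, ElemGate.apply_single, flipBit, Function.update_self,
    Function.update_idem, Function.update_of_ne hat, Function.update_of_ne hbt]
  cases hx : x t <;> rw [hx] at hu <;> cases x a <;> cases x b <;>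
    simp [hu, hadamardGate] <;> ring_nf <;> (simp only [inv_pow, h2]; ring)

end Rotations

/-! ### Preparation of dense states on few qubits -/

section DensePreparation

variable {Q : Type} [DecidableEq Q] [Fintype Q]

/-- `x` vanishes outside of `R`. -/
def ZeroOff (R : List Q) (x : Q → Bool) : Prop := ∀ q, q ∉ R → x q = false

omit [Fintype Q] in
theorem ZeroOff.update {q : Q} {R : List Q} {x : Q → Bool} {b : Bool}
    (h : ZeroOff (q :: R) (Function.update x q b)) (b' : Bool) :
    ZeroOff (q :: R) (Function.update x q b') := by
  intro j hj
  have hjq : j ≠ q := fun e => hj (by simp [e])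
  have := h j hj
  rwa [Function.update_of_ne hjq] at this ⊢

/-- Induction on the qubits. The two amplitudes differing only in the bit `q` are merged into their
Euclidean norm at `q = 0`; the merged state is prepared by induction. A rotation of `q`, controlled
by the other qubits, then splits each norm, the angle being the argument of the point of the plane
with these two amplitudes as coordinates. -/
theorem exists_circuit_nonneg (R : List Q) (hR : R.Nodup) (ρ : (Q → Bool) → ℝ)
    (hρ : ∀ x, 0 ≤ ρ x) (hs : ∀ x, ρ x ≠ 0 → ZeroOff R x) (h1 : ∑ x, ρ x ^ 2 = 1) :
    ∃ K : QCircuit Q, K.length ≤ 3 * 2 ^ R.length ∧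
      K.run (zeroState Q) = fun x => (ρ x : ℂ) := by
  induction R generalizing ρ with
  | nil =>
    have h0 : ∀ x, x ≠ (fun _ => false) → ρ x = 0 := by
      intro x hx
      by_contra h
      exact hx (funext fun q => hs x h q (by simp))
    rw [Finset.sum_eq_single (fun _ => false) (fun x _ hx => by simp [h0 x hx])
      (by simp)] at h1
    refine ⟨[], by simp, ?_⟩
    funext x
    rw [QCircuit.run_nil, zeroState]
    split_ifs with h
    · have : x = fun _ => false := funext h
      rw [this, (pow_eq_one_iff_of_nonneg (hρ _) two_ne_zero).1 h1]
      simp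
    · rw [h0 x (fun e => h fun q => by rw [e])]
      simp
  | cons q R ih =>
    obtain ⟨hqR, hR⟩ := List.nodup_cons.1 hR
    let ρ' : (Q → Bool) → ℝ := fun x =>
      if x q then 0 else √(ρ x ^ 2 + ρ (Function.update x q true) ^ 2)
    have hsum : ∑ x, ρ' x ^ 2 = 1 := by
      let e : (Q → Bool) ≃ (Q → Bool) := Function.Involutive.toPerm
        (fun x => Function.update x q (!(x q))) (fun x => by simp)
      have h2 : ∑ x, (if x q then 0 else ρ (Function.update x q true) ^ 2) =
          ∑ x, if x q then ρ x ^ 2 else 0 := by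
        rw [← Equiv.sum_comp e]
        refine Finset.sum_congr rfl fun x _ => ?_
        have : e x = Function.update x q (!(x q)) := rfl
        rw [this]
        cases hx : x q
        · simp
        · have hu := Function.update_eq_self q x
          rw [hx] at hu
          simp [hu]
      have h3 : ∀ x, ρ' x ^ 2 = (if x q then 0 else ρ x ^ 2) +
          (if x q then 0 else ρ (Function.update x q true) ^ 2) := by
        intro x
        cases hx : x q
        · simp only [ρ', hx]
          simp [Real.sq_sqrt (add_nonneg (sq_nonneg (ρ x))
            (sq_nonneg (ρ (Function.update x q true))))]
        · simp [ρ', hx]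
      rw [Finset.sum_congr rfl fun x _ => h3 x, Finset.sum_add_distrib, h2,
        ← Finset.sum_add_distrib, ← h1]
      refine Finset.sum_congr rfl fun x _ => ?_
      cases x q <;> simp
    obtain ⟨K, hK, hrun⟩ := ih hR ρ' (fun x => by
        simp only [ρ']; split_ifs; exacts [le_rfl, Real.sqrt_nonneg _]) (by
      intro x hx
      simp only [ρ'] at hx
      cases hxq : x q
      · rw [hxq] at hx
        have hz : ZeroOff (q :: R) x := by
          by_cases hx0 : ρ x = 0
          · have : ρ (Function.update x q true) ≠ 0 := by
              intro h; simp [hx0, h] at hx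
            have := (hs _ this).update (x q)
            rwa [Function.update_eq_self] at this
          · exact hs x hx0
        intro j hj
        by_cases hjq : j = q
        · rw [hjq, hxq]
        · exact hz j (by simp [hjq, hj])
      · simp [hxq] at hx) hsum
    -- Truncation to `R` makes the angle depend on the control qubits alone. Nothing is lost, as
    -- there is no amplitude on strings that are non-zero off `q :: R`.
    let res : (Q → Bool) → Q → Bool := fun x j => if j ∈ R then x j else false
    let θ : (Q → Bool) → ℝ := fun x =>
      Complex.arg ⟨ρ (res x), ρ (Function.update (res x) q true)⟩
    have hθ : DependsOnBits R θ := by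
      intro x y h
      have : res x = res y := by
        funext j
        by_cases hj : j ∈ R
        · simp [res, hj, h j hj]
        · simp [res, hj]
      simp only [θ, this]
    obtain ⟨K', hK', hrun'⟩ :=
      realizes_controlledGate rotationGate_add rotationGate_neg q R hqR θ hθ
    refine ⟨K ++ K', ?_, ?_⟩
    · have : 1 ≤ 2 ^ R.length := Nat.one_le_two_pow
      rw [List.length_append, List.length_cons, pow_succ]
      omega
    rw [QCircuit.run_append, hrun, hrun']
    funext x
    have hu := Function.update_eq_self q x
    simp only [controlledGate]
    have e1 : ρ' (Function.update x q true) = 0 := by simp [ρ']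
    have e2 : ρ' (Function.update x q false) =
        √(ρ (Function.update x q false) ^ 2 + ρ (Function.update x q true) ^ 2) := by
      simp [ρ']
    rw [e1, e2]
    by_cases hz : ZeroOff (q :: R) x
    · have hres : res x = Function.update x q false := by
        funext j
        by_cases hjq : j = q
        · subst hjq; simp [res, hqR]
        · by_cases hj : j ∈ R
          · simp [res, hj, hjq]
          · simp [res, hj, hjq, hz j (by simp [hj, hjq])]
      have hθx : θ x = Complex.arg ⟨ρ (Function.update x q false),
          ρ (Function.update x q true)⟩ := by
        simp only [θ, hres, Function.update_idem]
      have hn : √(ρ (Function.update x q false) ^ 2 + ρ (Function.update x q true) ^ 2) =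
          ‖(⟨ρ (Function.update x q false), ρ (Function.update x q true)⟩ : ℂ)‖ := by
        rw [Complex.norm_eq_sqrt_sq_add_sq]
      have hcos := Complex.norm_mul_cos_arg
        ⟨ρ (Function.update x q false), ρ (Function.update x q true)⟩
      have hsin := Complex.norm_mul_sin_arg
        ⟨ρ (Function.update x q false), ρ (Function.update x q true)⟩
      rw [← hθx, ← hn] at hcos hsin
      simp only at hcos hsin
      cases hx : x q
      · rw [hx] at hu
        rw [hu] at hcos
        rw [mul_comm] at hcos
        simp only [rotationGate, Matrix.of_apply, hu] at hcos ⊢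
        simp only [if_true, Complex.ofReal_zero, mul_zero, add_zero]
        exact_mod_cast hcos
      · rw [hx] at hu
        rw [hu] at hsin
        rw [mul_comm] at hsin
        simp only [rotationGate, Matrix.of_apply, hu] at hsin ⊢
        simp only [if_true, Bool.true_eq_false, if_false, Complex.ofReal_zero, mul_zero, add_zero]
        exact_mod_cast hsin
    · have hb : ∀ b, ρ (Function.update x q b) = 0 := by
        intro b
        by_contra h
        have := (hs _ h).update (x q)
        rw [hu] at this
        exact hz this
      have hx0 := hb (x q)
      rw [hu] at hx0
      simp [hb, hx0]

/-- Every state of the qubits in `R` can be prepared with `O(2 ^ |R|)` gates. -/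
theorem exists_circuit_of_zeroOff [Nonempty Q] (R : List Q) (hR : R.Nodup) (ψ : QState Q)
    (hs : ∀ x, ψ x ≠ 0 → ZeroOff R x) (h1 : ∑ x, ‖ψ x‖ ^ 2 = 1) :
    ∃ K : QCircuit Q, K.length ≤ 6 * 2 ^ R.length ∧ K.run (zeroState Q) = ψ := by
  obtain ⟨K, hK, hrun⟩ := exists_circuit_nonneg R hR (fun x => ‖ψ x‖) (fun x => norm_nonneg _)
    (fun x hx => hs x (norm_ne_zero_iff.1 hx)) h1
  let res : (Q → Bool) → Q → Bool := fun x j => if j ∈ R then x j else false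
  obtain ⟨K', hK', hrun'⟩ := realizes_diagonal R hR (fun x => Complex.arg (ψ (res x))) (by
    intro x y h
    have : res x = res y := by
      funext j
      by_cases hj : j ∈ R
      · simp [res, hj, h j hj]
      · simp [res, hj]
    simp only [this])
  refine ⟨K ++ K', by rw [List.length_append]; omega, ?_⟩
  rw [QCircuit.run_append, hrun, hrun']
  funext x
  by_cases hx : ψ x = 0
  · simp [hx]
  · have : res x = x := by
      funext j
      by_cases hj : j ∈ R
      · simp [res, hj]
      · simp [res, hj, hs x hx j hj]
    simp only [this]
    rw [mul_comm, Complex.norm_mul_exp_arg_mul_I]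

/-- If a circuit map moves the support of `ψ` to strings on few qubits, then `ψ` can be prepared
by preparing a dense state on these qubits first. -/
theorem exists_circuit_of_hasCircuit [Nonempty Q] (R : List Q) (hR : R.Nodup) (ψ : QState Q)
    (h1 : ∑ x, ‖ψ x‖ ^ 2 = 1) {f : (Q → Bool) → Q → Bool} {s : ℕ} (hf : HasCircuit f s)
    (hs : ∀ x, ψ x ≠ 0 → ZeroOff R (f x)) :
    ∃ K : QCircuit Q, K.length ≤ 6 * 2 ^ R.length + s ∧ K.run (zeroState Q) = ψ := by
  obtain ⟨g, -, hgf, hfg⟩ := hf.exists_inverse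
  obtain ⟨K', hK', hrun'⟩ := hf
  -- The dense state is `ψ` transported along `f`; since the circuit of `f` acts by precomposition,
  -- it turns `ψ ∘ g` back into `ψ`.
  obtain ⟨K, hK, hrun⟩ := exists_circuit_of_zeroOff R hR (ψ ∘ g) (fun x hx => by
      have := hs _ hx
      rwa [hfg] at this) (by
    rw [← h1]
    exact Equiv.sum_comp (⟨g, f, hfg, hgf⟩ : (Q → Bool) ≃ (Q → Bool)) fun x => ‖ψ x‖ ^ 2)
  refine ⟨K ++ K', by rw [List.length_append]; omega, ?_⟩
  rw [QCircuit.run_append, hrun, hrun']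
  funext x
  simp [hgf]

end DensePreparation

/-! ### Multiply controlled gates and exchange of bit patterns -/

section MultiControlled

set_option linter.unusedSectionVars false
set_option linter.unnecessarySeqFocus false

variable {Q : Type} [DecidableEq Q]

/-- For a list of pairs `(c₁, a₁), …, (cₖ, aₖ)`, add the product of the bits `cᵢ, …, cₖ` to the
bit `aᵢ`, for each `i`. -/
def ladder : List (Q × Q) → (Q → Bool) → Q → Bool
  | [], x => x
  | p :: l, x => ladder l (flipBit p.2 (fun x => x p.1 && l.all fun r => x r.1) x)

theorem ladder_of_notMem (l : List (Q × Q)) (x : Q → Bool) {j : Q} (hj : j ∉ l.map Prod.snd) :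
    ladder l x j = x j := by
  induction l generalizing x with
  | nil => rfl
  | cons p l ih =>
    simp only [List.map_cons, List.mem_cons, not_or] at hj
    rw [ladder, ih _ hj.2, flipBit_of_ne hj.1]

theorem all_update (l : List (Q × Q)) (x : Q → Bool) {j : Q} (b : Bool)
    (h1 : j ∉ l.map Prod.fst) :
    (l.all fun r => Function.update x j b r.1) = l.all fun r => x r.1 := by
  induction l with
  | nil => rfl
  | cons p l ih =>
    simp only [List.map_cons, List.mem_cons, not_or] at h1
    rw [List.all_cons, List.all_cons, ih h1.2, Function.update_of_ne (Ne.symm h1.1)]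

theorem ladder_update (l : List (Q × Q)) (x : Q → Bool) {j : Q} (b : Bool)
    (h1 : j ∉ l.map Prod.fst) (h2 : j ∉ l.map Prod.snd) :
    ladder l (Function.update x j b) = Function.update (ladder l x) j b := by
  induction l generalizing x with
  | nil => rfl
  | cons p l ih =>
    simp only [List.map_cons, List.mem_cons, not_or] at h1 h2
    rw [ladder, ladder, ← ih _ h1.2 h2.2]
    congr 1
    simp only [flipBit]
    rw [all_update l x b h1.2, Function.update_of_ne (Ne.symm h1.1),
      Function.update_of_ne (Ne.symm h2.1), Function.update_comm h2.1]

/-- The first target receives `c₁ a₂` before the rest of the ladder runs and `c₁ (a₂ + c₂ ⋯ cₖ)`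
after it; the unknown content of `a₂` cancels. Each rung therefore costs two Toffoli gates, and the
targets may start in any state. -/
theorem hasCircuit_ladder (l : List (Q × Q)) (h1 : (l.map Prod.fst).Nodup)
    (h2 : (l.map Prod.snd).Nodup) (h12 : (l.map Prod.fst).Disjoint (l.map Prod.snd)) :
    HasCircuit (ladder l) (52 * l.length) := by
  induction l with
  | nil => exact HasCircuit.id
  | cons p l ih =>
    simp only [List.map_cons, List.nodup_cons, List.disjoint_cons_left,
      List.disjoint_cons_right, List.mem_cons, not_or] at h1 h2 h12
    obtain ⟨⟨hac, ha1⟩, hc2, hd⟩ := h12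
    have hca : p.1 ≠ p.2 := Ne.symm hac
    have hl := ih h1.2 h2.2 hd
    cases l with
    | nil =>
      refine HasCircuit.mono ?_ (show 1 ≤ _ by simp)
      convert hasCircuit_cnot hca using 1
      funext x
      simp [ladder]
    | cons p' l =>
      have hne : p'.2 ≠ p.2 := fun h => h2.1 (by simp [h])
      have hne' : p.1 ≠ p'.2 := fun h => hc2 (by simp [h])
      have hU := hasCircuit_toffoli (a := p.1) (b := p'.2) (t := p.2) hne' hca hne
      refine HasCircuit.mono ?_ (show 26 + (52 * (p' :: l).length + 26) ≤ _ by
        simp only [List.length_cons]; omega)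
      convert hU.comp (hl.comp hU) using 1
      funext x
      rw [ladder]
      simp only [Function.comp, flipBit]
      rw [ladder_update _ _ _ ha1 h2.1, ladder_update _ _ _ ha1 h2.1]
      simp only [Function.update_self, Function.update_idem, Function.update_of_ne hca,
        Function.update_of_ne hne, ladder_of_notMem _ _ hc2]
      congr 1
      have : ladder (p' :: l) x p'.2 = xor (x p'.2) ((p' :: l).all fun r => x r.1) := by
        rw [ladder, ladder_of_notMem _ _ (List.nodup_cons.1 h2.2).1, flipBit_self, List.all_cons]
      rw [this]
      cases x p.2 <;> cases x p.1 <;> cases x p'.2 <;> simp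

/-- The full ladder followed by the inverse of its tail restores all targets except the first. -/
theorem hasCircuit_all (p : Q × Q) (l : List (Q × Q)) (h1 : ((p :: l).map Prod.fst).Nodup)
    (h2 : ((p :: l).map Prod.snd).Nodup)
    (h12 : ((p :: l).map Prod.fst).Disjoint ((p :: l).map Prod.snd)) [Fintype Q] :
    HasCircuit (flipBit p.2 fun x => x p.1 && l.all fun r => x r.1)
      (52 * l.length + 52 * (l.length + 1)) := by
  have hl := hasCircuit_ladder _ h1 h2 h12
  simp only [List.map_cons, List.nodup_cons, List.disjoint_cons_left,
    List.disjoint_cons_right, List.mem_cons, not_or] at h1 h2 h12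
  obtain ⟨g, hg, hg', -⟩ := (hasCircuit_ladder l h1.2 h2.2 h12.2.2).exists_inverse
  rw [← List.length_cons (a := p)]
  convert hg.comp hl using 1
  funext x
  rw [Function.comp, ladder, hg']

variable [Fintype Q]

omit [Fintype Q] in
theorem hasCircuit_flipBit_false (t : Q) : HasCircuit (flipBit t fun _ => false) 0 := by
  convert HasCircuit.id (Q := Q) using 1
  funext x
  simp [flipBit]

/-- A multiply controlled NOT gate, in the presence of many spare qubits. -/
theorem hasCircuit_controls_of_dirty (C Y : Finset Q) (t : Q) (hC : t ∉ C) (hY : t ∉ Y)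
    (hCY : Disjoint C Y) (hcard : C.card ≤ Y.card + 1) :
    HasCircuit (flipBit t fun x => decide (∀ c ∈ C, x c = true)) (104 * (C.card + 1)) := by
  rcases C.eq_empty_or_nonempty with rfl | ⟨c, hc⟩
  · simpa using (hasCircuit_not t).mono (show 1 ≤ 104 by norm_num)
  have hc' : (C.erase c).card = C.card - 1 := Finset.card_erase_of_mem hc
  have hpos : 0 < C.card := Finset.card_pos.2 ⟨c, hc⟩
  -- The rung of `c` targets `t` itself; every other control borrows one qubit of `Y` as its target.
  obtain ⟨Z, hZY, hZ⟩ := Finset.exists_subset_card_eq (show (C.erase c).card ≤ Y.card by omega)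
  have hlen : (C.erase c).toList.length = Z.toList.length := by simp [hZ]
  have hfst : ((C.erase c).toList.zip Z.toList).map Prod.fst = (C.erase c).toList :=
    List.map_fst_zip hlen.le
  have hsnd : ((C.erase c).toList.zip Z.toList).map Prod.snd = Z.toList :=
    List.map_snd_zip hlen.ge
  have H := hasCircuit_all (c, t) ((C.erase c).toList.zip Z.toList)
    (by rw [List.map_cons, hfst, List.nodup_cons]; simp [Finset.nodup_toList])
    (by rw [List.map_cons, hsnd, List.nodup_cons]
        simpa [Finset.nodup_toList] using fun h => hY (hZY h))
    (by
      rw [List.map_cons, List.map_cons, hfst, hsnd]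
      intro a ha hb
      simp only at ha hb
      have h1 : a ∈ C := by
        rcases List.mem_cons.1 ha with h | h
        · rw [h]; exact hc
        · exact Finset.mem_of_mem_erase (Finset.mem_toList.1 h)
      rcases List.mem_cons.1 hb with h | h
      · exact hC (h ▸ h1 : t ∈ C)
      · exact Finset.disjoint_left.1 hCY h1 (hZY (Finset.mem_toList.1 h)))
  have hl : ((C.erase c).toList.zip Z.toList).length = C.card - 1 := by
    rw [List.length_zip, ← hlen]; simp [hc']
  rw [hl] at H
  refine HasCircuit.mono ?_ (show 52 * (C.card - 1) + 52 * (C.card - 1 + 1) ≤ _ by omega)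
  convert H using 2
  funext x
  have : (((C.erase c).toList.zip Z.toList).all fun r => x r.1) =
      ((C.erase c).toList.all fun r => x r) := by
    conv_rhs => rw [← hfst]
    rw [List.all_map]; rfl
  rw [this, Bool.eq_iff_iff]
  simp only [decide_eq_true_eq, Bool.and_eq_true, List.all_eq_true, Finset.mem_toList,
    Finset.mem_erase]
  constructor
  · exact fun h => ⟨h c hc, fun a ha => h a ha.2⟩
  · rintro ⟨h, h'⟩ a ha
    by_cases hac : a = c
    · rwa [hac]
    · exact h' a ⟨hac, ha⟩

/-- A multiply controlled NOT gate, in the presence of one spare qubit. -/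
theorem hasCircuit_controls (C : Finset Q) (t : Q) (ht : t ∉ C)
    (hcard : C.card + 2 ≤ Fintype.card Q) :
    HasCircuit (flipBit t fun x => decide (∀ c ∈ C, x c = true)) (208 * (C.card + 3)) := by
  obtain ⟨s, hs⟩ : ∃ s, s ∉ insert t C := by
    by_contra! h
    have := Finset.card_le_card (fun s _ => h s : Finset.univ ⊆ insert t C)
    rw [Finset.card_univ, Finset.card_insert_of_notMem ht] at this
    omega
  simp only [Finset.mem_insert, not_or] at hs
  obtain ⟨hst, hsC⟩ := hs
  -- The controls are halved so that each half can borrow the other. With `s` flipped by the first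
  -- half, and `t` by `s` and the second half, doing both twice restores `s` and adds the product of
  -- all controls to `t`.
  obtain ⟨C₁, hC₁, hcard₁⟩ := Finset.exists_subset_card_eq
    (show (C.card + 1) / 2 ≤ C.card by omega)
  have hcard₂ : (C \ C₁).card = C.card - (C.card + 1) / 2 := by
    rw [Finset.card_sdiff_of_subset hC₁, hcard₁]
  have hs₂ : s ∉ C \ C₁ := fun h => hsC (Finset.mem_sdiff.1 h).1
  have ht₂ : t ∉ C \ C₁ := fun h => ht (Finset.mem_sdiff.1 h).1
  have h1 := hasCircuit_controls_of_dirty C₁ (C \ C₁) s (fun h => hsC (hC₁ h)) hs₂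
    Finset.disjoint_sdiff (by omega)
  have h2 := hasCircuit_controls_of_dirty (insert s (C \ C₁)) C₁ t
    (by simp [Ne.symm hst, ht]) (fun h => ht (hC₁ h))
    (by
      rw [Finset.disjoint_insert_left]
      exact ⟨fun h => hsC (hC₁ h), Finset.sdiff_disjoint⟩)
    (by rw [Finset.card_insert_of_notMem hs₂]; omega)
  rw [Finset.card_insert_of_notMem hs₂] at h2
  refine HasCircuit.mono ?_ (show 104 * ((C \ C₁).card + 1 + 1) + (104 * (C₁.card + 1) +
    (104 * ((C \ C₁).card + 1 + 1) + 104 * (C₁.card + 1))) ≤ _ by omega)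
  convert h2.comp (h1.comp (h2.comp h1)) using 1
  funext x
  have e1 : ∀ x : Q → Bool, ∀ b, (∀ c ∈ C₁, Function.update x t b c = true) ↔
      ∀ c ∈ C₁, x c = true := fun x b => forall₂_congr fun c hc => by
    rw [Function.update_of_ne (fun h : c = t => ht (h ▸ hC₁ hc))]
  have e2 : ∀ x : Q → Bool, ∀ b, (∀ c ∈ C₁, Function.update x s b c = true) ↔
      ∀ c ∈ C₁, x c = true := fun x b => forall₂_congr fun c hc => by
    rw [Function.update_of_ne (fun h : c = s => hsC (h ▸ hC₁ hc))]
  have e3 : ∀ x : Q → Bool, ∀ b, (∀ c ∈ C \ C₁, Function.update x s b c = true) ↔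
      ∀ c ∈ C \ C₁, x c = true := fun x b => forall₂_congr fun c hc => by
    rw [Function.update_of_ne (fun h : c = s => hs₂ (h ▸ hc))]
  have e4 : ∀ x : Q → Bool, ∀ b, (∀ c ∈ C \ C₁, Function.update x t b c = true) ↔
      ∀ c ∈ C \ C₁, x c = true := fun x b => forall₂_congr fun c hc => by
    rw [Function.update_of_ne (fun h : c = t => ht₂ (h ▸ hc))]
  have e5 : (∀ c ∈ C, x c = true) ↔ (∀ c ∈ C₁, x c = true) ∧ ∀ c ∈ C \ C₁, x c = true := by
    constructor
    · exact fun h => ⟨fun c hc => h c (hC₁ hc), fun c hc => h c (Finset.mem_sdiff.1 hc).1⟩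
    · rintro ⟨h, h'⟩ c hc
      by_cases hc₁ : c ∈ C₁
      · exact h c hc₁
      · exact h' c (Finset.mem_sdiff.2 ⟨hc, hc₁⟩)
  simp only [Function.comp, flipBit, Finset.forall_mem_insert, e1, e2, e3, e4, e5,
    Function.update_self, Function.update_of_ne hst, Function.update_of_ne (Ne.symm hst),
    Bool.decide_and]
  generalize decide (∀ c ∈ C₁, x c = true) = A
  generalize decide (∀ c ∈ C \ C₁, x c = true) = B
  funext j
  by_cases hjt : j = t
  · subst hjt
    simp only [Function.update_self]
    cases A <;> cases B <;> cases x j <;> cases x s <;> rfl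
  · by_cases hjs : j = s
    · subst hjs
      simp [hst]
    · simp [hjt, hjs]

/-- Flip a bit if the bits in `C` have the prescribed values. -/
theorem hasCircuit_matches (C : Finset Q) (v : Q → Bool) (t : Q) (ht : t ∉ C)
    (hcard : C.card + 2 ≤ Fintype.card Q) :
    HasCircuit (flipBit t fun x => decide (∀ c ∈ C, x c = v c)) (700 * (C.card + 1)) := by
  have h1 := hasCircuit_controls C t ht hcard
  -- Conjugation by NOT gates where `v` is `false` reduces to the case that all controls must be
  -- set.
  have h2 : HasCircuit (flipBits C fun j _ => !(v j)) (C.card * 1) := by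
    refine hasCircuit_flipBits (fun j _ => ?_) fun j _ x y _ => rfl
    cases v j
    · exact hasCircuit_not j
    · simpa using (hasCircuit_flipBit_false j).mono (Nat.zero_le 1)
  refine HasCircuit.mono ?_ (show C.card * 1 + (208 * (C.card + 3) + C.card * 1) ≤ _ by omega)
  convert h2.comp (h1.comp h2) using 1
  have hn : ∀ y, ∀ j ∈ C, flipBits C (fun j _ => !(v j)) y j = xor (y j) (!(v j)) :=
    fun y j hj => by rw [flipBits, if_pos hj]
  have hn' : ∀ y, ∀ j ∉ C, flipBits C (fun j _ => !(v j)) y j = y j :=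
    fun y j hj => by rw [flipBits, if_neg hj]
  funext x j
  simp only [Function.comp]
  by_cases hj : j ∈ C
  · have hjt : j ≠ t := fun h => ht (h ▸ hj)
    rw [flipBit_of_ne hjt, hn _ j hj, flipBit_of_ne hjt, hn _ j hj]
    simp
  · rw [hn' _ j hj]
    by_cases hjt : j = t
    · subst hjt
      rw [flipBit_self, flipBit_self, hn' _ j hj]
      congr 2
      rw [eq_iff_iff]
      refine forall₂_congr fun c hc => ?_
      rw [hn _ c hc]
      cases x c <;> cases v c <;> simp
    · rw [flipBit_of_ne hjt, flipBit_of_ne hjt, hn' _ j hj]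

/-- Exchange the patterns `u` and `v` on the set `J` of qubits. -/
def swapPattern (J : Finset Q) (u v : Q → Bool) (x : Q → Bool) : Q → Bool :=
  if xor (decide (∀ j ∈ J, x j = u j)) (decide (∀ j ∈ J, x j = v j)) then
    fun j => if j ∈ J then xor (x j) (xor (u j) (v j)) else x j else x

theorem swapPattern_of_eq {J : Finset Q} {u v x : Q → Bool} (hx : ∀ j ∈ J, x j = u j)
    (huv : ∃ j ∈ J, u j ≠ v j) :
    swapPattern J u v x = fun j => if j ∈ J then v j else x j := by
  obtain ⟨i, hi, hne⟩ := huv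
  have : ¬ ∀ j ∈ J, x j = v j := fun h => hne ((hx i hi).symm.trans (h i hi))
  rw [swapPattern, if_pos (by rw [decide_eq_true hx, decide_eq_false this]; rfl)]
  funext j
  by_cases hj : j ∈ J
  · rw [if_pos hj, if_pos hj, hx j hj]
    cases u j <;> cases v j <;> rfl
  · rw [if_neg hj, if_neg hj]

theorem swapPattern_of_eq' {J : Finset Q} {u v x : Q → Bool} (hx : ∀ j ∈ J, x j = v j)
    (huv : ∃ j ∈ J, u j ≠ v j) :
    swapPattern J u v x = fun j => if j ∈ J then u j else x j := by
  obtain ⟨i, hi, hne⟩ := huv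
  have : ¬ ∀ j ∈ J, x j = u j := fun h => hne ((h i hi).symm.trans (hx i hi))
  rw [swapPattern, if_pos (by rw [decide_eq_false this, decide_eq_true hx]; rfl)]
  funext j
  by_cases hj : j ∈ J
  · rw [if_pos hj, if_pos hj, hx j hj]
    cases u j <;> cases v j <;> rfl
  · rw [if_neg hj, if_neg hj]

theorem swapPattern_of_ne {J : Finset Q} {u v x : Q → Bool} (hu : ∃ j ∈ J, x j ≠ u j)
    (hv : ∃ j ∈ J, x j ≠ v j) : swapPattern J u v x = x := by
  have h1 : ¬ ∀ j ∈ J, x j = u j := by push Not; exact hu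
  have h2 : ¬ ∀ j ∈ J, x j = v j := by push Not; exact hv
  simp only [swapPattern, h1, h2]
  simp

/-- The test `E` for one of the two patterns is added to a spare qubit `f`, `u + v` is added to `J`
under control of `f`, and both operations are repeated. Adding `u + v` preserves `E`, so `f` is
restored, and `J` changes under control of `(f + E) + f = E`; the initial value of `f` is
irrelevant. The tests need a second spare qubit. -/
theorem hasCircuit_swapPattern (J : Finset Q) (u v : Q → Bool)
    (hcard : J.card + 2 ≤ Fintype.card Q) :
    HasCircuit (swapPattern J u v) (3000 * (J.card + 1)) := by
  obtain ⟨f, hf⟩ : ∃ f, f ∉ J := by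
    by_contra! h
    have := Finset.card_le_card (fun s _ => h s : Finset.univ ⊆ J)
    rw [Finset.card_univ] at this
    omega
  have hupd : ∀ (w x : Q → Bool) (b : Bool), (∀ j ∈ J, Function.update x f b j = w j) ↔
      ∀ j ∈ J, x j = w j := fun w x b => forall₂_congr fun j hj => by
    rw [Function.update_of_ne (fun h : j = f => hf (h ▸ hj))]
  let E : (Q → Bool) → Bool := fun x =>
    xor (decide (∀ j ∈ J, x j = u j)) (decide (∀ j ∈ J, x j = v j))
  have hE : HasCircuit (flipBit f E) (700 * (J.card + 1) + 700 * (J.card + 1)) :=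
    (hasCircuit_matches J u f hf hcard).flipBit_xor (hasCircuit_matches J v f hf hcard)
      fun x b => by simp only [hupd]
  let A : (Q → Bool) → Q → Bool := flipBits J fun j x => x f && xor (u j) (v j)
  have hA : HasCircuit A (J.card * 1) := by
    refine hasCircuit_flipBits (fun j hj => ?_) fun j _ x y h => by rw [h f hf]
    have hfj : f ≠ j := fun h => hf (h ▸ hj)
    cases h : xor (u j) (v j)
    · simpa using (hasCircuit_flipBit_false j).mono (Nat.zero_le 1)
    · simpa using hasCircuit_cnot hfj
  refine HasCircuit.mono ?_ (show J.card * 1 + ((700 * (J.card + 1) + 700 * (J.card + 1)) +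
    (J.card * 1 + (700 * (J.card + 1) + 700 * (J.card + 1)))) ≤ _ by omega)
  convert hA.comp (hE.comp (hA.comp hE)) using 1
  have hEf : ∀ x b, E (Function.update x f b) = E x := fun x b => by simp only [E, hupd]
  have hEA : ∀ x, E (A x) = E x := by
    intro x
    cases hxf : x f
    · have : A x = x := by
        funext j
        simp [A, flipBits, hxf]
      rw [this]
    · have h1 : (∀ j ∈ J, A x j = u j) ↔ ∀ j ∈ J, x j = v j := forall₂_congr fun j hj => by
        simp only [A, flipBits, if_pos hj, hxf]
        cases x j <;> cases u j <;> cases v j <;> simp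
      have h2 : (∀ j ∈ J, A x j = v j) ↔ ∀ j ∈ J, x j = u j := forall₂_congr fun j hj => by
        simp only [A, flipBits, if_pos hj, hxf]
        cases x j <;> cases u j <;> cases v j <;> simp
      simp only [E, h1, h2, Bool.xor_comm]
  have hAf : ∀ x, A x f = x f := fun x => by simp [A, flipBits, hf]
  have hEfl : ∀ x, E (flipBit f E x) = E x := fun x => hEf _ _
  funext x j
  have hsp : swapPattern J u v x =
      if E x then fun j => if j ∈ J then xor (x j) (xor (u j) (v j)) else x j else x := rfl
  rw [hsp]
  simp only [Function.comp]
  by_cases hj : j ∈ J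
  · have hjf : j ≠ f := fun h => hf (h ▸ hj)
    have hAj : ∀ y, A y j = xor (y j) (y f && xor (u j) (v j)) := fun y => by
      simp [A, flipBits, hj]
    simp only [hAj, flipBit_of_ne hjf, flipBit_self, hAf, hEA, hEfl]
    cases E x <;> simp [hj] <;> cases x j <;> cases x f <;> cases u j <;> cases v j <;> rfl
  · have hAj : ∀ y, A y j = y j := fun y => by simp [A, flipBits, hj]
    by_cases hjf : j = f
    · subst hjf
      simp only [hAj, flipBit_self, hEA, hEfl]
      cases E x <;> simp [hj]
    · simp only [hAj, flipBit_of_ne hjf]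
      cases E x <;> simp [hj]

/-- Move the patterns `u i` to the patterns `v i`, all of them being different. -/
theorem exists_hasCircuit_swapPatterns {ι : Type} [DecidableEq ι] (J : Finset Q)
    (hcard : J.card + 2 ≤ Fintype.card Q) (u v : ι → Q → Bool)
    (huu : ∀ i i', i ≠ i' → ∃ j ∈ J, u i j ≠ u i' j)
    (hvv : ∀ i i', i ≠ i' → ∃ j ∈ J, v i j ≠ v i' j)
    (huv : ∀ i i', ∃ j ∈ J, u i j ≠ v i' j) (I : Finset ι) :
    ∃ W, HasCircuit W (I.card * (3000 * (J.card + 1))) ∧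
      (∀ x, ∀ j ∉ J, W x j = x j) ∧
      (∀ i ∈ I, ∀ x, (∀ j ∈ J, x j = u i j) → W x = fun j => if j ∈ J then v i j else x j) ∧
      ∀ x, (∀ i ∈ I, (∃ j ∈ J, x j ≠ u i j) ∧ ∃ j ∈ J, x j ≠ v i j) → W x = x := by
  induction I using Finset.induction with
  | empty => exact ⟨_, HasCircuit.id.mono (by simp), by simp⟩
  | insert a I ha ih =>
    obtain ⟨W, hW, hoff, hmap, hfix⟩ := ih
    -- All patterns involved are different, so the exchanges are disjoint transpositions and do not
    -- disturb each other.
    refine ⟨W ∘ swapPattern J (u a) (v a), ?_, ?_, ?_, ?_⟩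
    · refine (hW.comp (hasCircuit_swapPattern J (u a) (v a) hcard)).mono ?_
      rw [Finset.card_insert_of_notMem ha, add_mul, one_mul]
    · intro x j hj
      rw [Function.comp, hoff _ j hj, swapPattern]
      split_ifs <;> simp [hj]
    · intro i hi x hx
      rw [Function.comp]
      by_cases hia : i = a
      · subst hia
        rw [swapPattern_of_eq hx (huv i i), hfix]
        intro i' hi'
        have hne : i ≠ i' := fun h => ha (h ▸ hi')
        obtain ⟨j, hj, h⟩ := huv i' i
        obtain ⟨j', hj', h'⟩ := hvv i i' hne
        exact ⟨⟨j, hj, by simpa [hj] using h.symm⟩, ⟨j', hj', by simpa [hj'] using h'⟩⟩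
      · obtain ⟨j, hj, h⟩ := huu i a hia
        obtain ⟨j', hj', h'⟩ := huv i a
        rw [swapPattern_of_ne ⟨j, hj, by rwa [hx j hj]⟩ ⟨j', hj', by rwa [hx j' hj']⟩]
        exact hmap i ((Finset.mem_insert.1 hi).resolve_left hia) x hx
    · intro x hx
      have := hx a (Finset.mem_insert_self a I)
      rw [Function.comp, swapPattern_of_ne this.1 this.2]
      exact hfix x fun i hi => hx i (Finset.mem_insert_of_mem hi)

end MultiControlled

/-! ### Moving a batch of strings at linear cost -/

section WithoutAncillas

variable {Q : Type} [DecidableEq Q] [Fintype Q]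

/-- A batch of few strings can be moved into the strings vanishing off `R` by linearly many
gates. -/
theorem exists_hasCircuit_batch (R : List Q) {t : ℕ} (x y : Fin t → Q → Bool)
    (hx : Function.Injective x) (hy : Function.Injective y) (hxR : ∀ i, ¬ ZeroOff R (x i))
    (hyR : ∀ i, ZeroOff R (y i)) (hcard : R.length + 4 ^ t + t + 3 ≤ Fintype.card Q) :
    ∃ g, HasCircuit g (1402 * Fintype.card Q + 6000 * (t * (4 ^ t + 2))) ∧
      (∀ i, g (x i) = y i) ∧ ∀ z, ZeroOff R z → (∀ i, z ≠ y i) → g z = z := by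
  have hne : Nonempty Q := Fintype.card_pos_iff.1 (lt_of_lt_of_le (Nat.succ_pos _) hcard)
  -- The column of the qubit `j` in the matrix with rows `x i` and `y i`. Qubits with equal columns
  -- share a representative, and there are at most `4 ^ t` representatives.
  let pat : Q → (Fin t → Bool) × (Fin t → Bool) := fun j => (fun i => x i j, fun i => y i j)
  let rep : Q → Q := fun j => Function.invFun pat (pat j)
  have hrep : ∀ j, pat (rep j) = pat j := fun j => Function.invFun_eq ⟨j, rfl⟩
  have hrepx : ∀ i j, x i (rep j) = x i j := fun i j =>
    congrFun (congrArg Prod.fst (hrep j)) i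
  have hrepy : ∀ i j, y i (rep j) = y i j := fun i j =>
    congrFun (congrArg Prod.snd (hrep j)) i
  let T : Finset Q := Finset.univ.image (Function.invFun pat)
  have hrepT : ∀ j, rep j ∈ T := fun j => Finset.mem_image_of_mem _ (Finset.mem_univ _)
  have hTcard : T.card ≤ 4 ^ t := by
    refine Finset.card_image_le.trans ?_
    rw [Finset.card_univ, Fintype.card_prod]
    simp [← mul_pow]
  have hTpos : 0 < T.card := Finset.card_pos.2 ⟨_, hrepT (Classical.arbitrary Q)⟩
  have hp : ∀ i, ∃ p, p ∉ R ∧ x i p = true := by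
    intro i
    have := hxR i
    simp only [ZeroOff, not_forall, Bool.not_eq_false] at this
    obtain ⟨p, hp, h⟩ := this
    exact ⟨p, hp, h⟩
  choose p hpR hpx using hp
  -- A flag qubit. It avoids `R`, where the targets live, the representatives, and the witnesses `p
  -- i` that `x i` is not supported on `R`.
  obtain ⟨q, hq⟩ : ∃ q, q ∉ R.toFinset ∪ T ∪ Finset.univ.image p := by
    by_contra! h
    have h1 := Finset.card_le_card
      (fun s _ => h s : Finset.univ ⊆ R.toFinset ∪ T ∪ Finset.univ.image p)
    have h2 := Finset.card_union_le (R.toFinset ∪ T) (Finset.univ.image p)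
    have h3 := Finset.card_union_le R.toFinset T
    have h4 := R.toFinset_card_le
    have h5 : (Finset.univ.image p).card ≤ t := Finset.card_image_le.trans (by simp)
    rw [Finset.card_univ] at h1
    omega
  simp only [Finset.mem_union, List.mem_toFinset, Finset.mem_image, Finset.mem_univ, true_and,
    not_or, not_exists] at hq
  obtain ⟨⟨hqR, hqT⟩, hqp⟩ := hq
  -- the linear map clearing all bits outside of `T`
  let L : (Q → Bool) → Q → Bool := flipBits Tᶜ fun j x => x (rep j)
  have hLp : ∀ j ∈ Tᶜ, ∀ x y : Q → Bool, (∀ i, i ∉ Tᶜ → x i = y i) → x (rep j) = y (rep j) :=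
    fun j _ x y h => h _ (by simpa using hrepT j)
  have hL : HasCircuit L (Tᶜ.card * 1) := by
    refine hasCircuit_flipBits (fun j hj => hasCircuit_cnot fun h => ?_) hLp
    exact Finset.mem_compl.1 hj (h ▸ hrepT j)
  have hLL : ∀ x, L (L x) = x := flipBits_flipBits hLp
  have hLT : ∀ w, ∀ j ∈ T, L w j = w j := fun w j hj => by simp [L, flipBits, hj]
  have hLn : ∀ w, ∀ j ∉ T, L w j = xor (w j) (w (rep j)) := fun w j hj => by
    simp [L, flipBits, hj]
  have hLx : ∀ i, ∀ j ∉ T, L (x i) j = false := fun i j hj => by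
    simp [L, flipBits, hj, hrepx]
  have hLy : ∀ i, ∀ j ∉ T, L (y i) j = false := fun i j hj => by
    simp [L, flipBits, hj, hrepy]
  have hdist : ∀ a b, (∀ j ∉ T, L a j = false) → (∀ j ∉ T, L b j = false) →
      (∀ j ∈ T, a j = b j) → a = b := by
    intro a b ha hb hab
    rw [← hLL a, ← hLL b]
    congr 1
    funext j
    by_cases hj : j ∈ T
    · rw [hLT _ j hj, hLT _ j hj, hab j hj]
    · rw [ha j hj, hb j hj]
  let J := insert q T
  have hJcard : J.card = T.card + 1 := Finset.card_insert_of_notMem hqT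
  have hqJ : q ∈ J := Finset.mem_insert_self q T
  have hTJ : ∀ j ∈ T, j ∈ J := fun j hj => Finset.mem_insert_of_mem hj
  have hTq : ∀ j ∈ T, j ≠ q := fun j hj h => hqT (h ▸ hj)
  let u : Fin t → Q → Bool := fun i => Function.update (x i) q true
  let v : Fin t → Q → Bool := fun i => Function.update (y i) q true
  have huT : ∀ i, ∀ j ∈ T, u i j = x i j := fun i j hj => by
    simp [u, hTq j hj]
  have hvT : ∀ i, ∀ j ∈ T, v i j = y i j := fun i j hj => by
    simp [v, hTq j hj]
  have huq : ∀ i, u i q = true := fun i => by simp [u]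
  have hvq : ∀ i, v i q = true := fun i => by simp [v]
  obtain ⟨W, hW, hWoff, hWmap, hWfix⟩ := exists_hasCircuit_swapPatterns J (by omega) u v
    (by
      intro i i' hii
      by_contra! h
      refine hii (hx (hdist _ _ (hLx i) (hLx i') fun j hj => ?_))
      rw [← huT i j hj, ← huT i' j hj, h j (hTJ j hj)])
    (by
      intro i i' hii
      by_contra! h
      refine hii (hy (hdist _ _ (hLy i) (hLy i') fun j hj => ?_))
      rw [← hvT i j hj, ← hvT i' j hj, h j (hTJ j hj)])
    (by
      intro i i'
      by_contra! h
      refine hxR i ((hdist _ _ (hLx i) (hLy i') fun j hj => ?_) ▸ hyR i')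
      rw [← huT i j hj, ← hvT i' j hj, h j (hTJ j hj)])
    Finset.univ
  obtain ⟨W', hW', hW'W, -⟩ := hW.exists_inverse
  have hWq : ∀ w, w q = false → W w = w := fun w hw => hWfix w fun i _ =>
    ⟨⟨q, hqJ, by rw [hw, huq]; decide⟩, ⟨q, hqJ, by rw [hw, hvq]; decide⟩⟩
  -- After `L`, all sources and targets vanish off `T`, so they satisfy `P`. Neither `W` nor a flip
  -- of `q` changes `P`, which allows the flag to be cleared later.
  let P : (Q → Bool) → Bool := fun w => decide (∀ c ∈ Jᶜ, w c = false)
  have hCcard : Jᶜ.card = Fintype.card Q - J.card := Finset.card_compl J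
  have hF : HasCircuit (flipBit q P) (700 * (Jᶜ.card + 1)) :=
    hasCircuit_matches Jᶜ (fun _ => false) q (by simpa using hqJ) (by omega)
  have hPcongr : ∀ w w' : Q → Bool, (∀ j ∉ J, w j = w' j) → P w = P w' := by
    intro w w' h
    simp only [P]
    congr 1
    rw [eq_iff_iff]
    exact forall₂_congr fun c hc => by rw [h c (Finset.mem_compl.1 hc)]
  have hPW : ∀ w, P (W w) = P w := fun w => hPcongr _ _ fun j hj => hWoff w j hj
  have hPu : ∀ w b, P (Function.update w q b) = P w := fun w b => hPcongr _ _ fun j hj => by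
    rw [Function.update_of_ne (fun h : j = q => hj (h ▸ hqJ))]
  -- The flag is set, the flagged patterns are exchanged, the flag is cleared. The final `W'` does
  -- nothing when `q = 0`; it repairs strings violating `P` that `W` altered because their bit `q`
  -- happened to be set.
  refine ⟨L ∘ W' ∘ flipBit q P ∘ W ∘ flipBit q P ∘ L, ?_, ?_, ?_⟩
  · refine (hL.comp (hW'.comp (hF.comp (hW.comp (hF.comp hL))))).mono ?_
    have h1 : Tᶜ.card ≤ Fintype.card Q := Finset.card_le_univ _
    have h2 : (Finset.univ : Finset (Fin t)).card * (3000 * (J.card + 1)) ≤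
        3000 * (t * (4 ^ t + 2)) := by
      rw [Finset.card_univ, Fintype.card_fin, mul_left_comm]
      exact Nat.mul_le_mul_left _ (Nat.mul_le_mul_left _ (by omega))
    generalize (Finset.univ : Finset (Fin t)).card * (3000 * (J.card + 1)) = w at h2 ⊢
    generalize t * (4 ^ t + 2) = w' at h2 ⊢
    have h3 : Jᶜ.card + 1 ≤ Fintype.card Q := by omega
    linarith
  · intro i
    have hP : P (L (x i)) = true := by
      simp only [P, decide_eq_true_eq]
      exact fun c hc => hLx i c fun h => Finset.mem_compl.1 hc (hTJ c h)
    have hP' : P (L (y i)) = true := by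
      simp only [P, decide_eq_true_eq]
      exact fun c hc => hLy i c fun h => Finset.mem_compl.1 hc (hTJ c h)
    have e1 : flipBit q P (L (x i)) = Function.update (L (x i)) q true := by
      rw [flipBit, hP, hLx i q hqT]; rfl
    have e2 : W (Function.update (L (x i)) q true) = Function.update (L (y i)) q true := by
      rw [hWmap i (Finset.mem_univ i)]
      · funext j
        by_cases hjq : j = q
        · subst hjq; simp [hqJ, hvq]
        · by_cases hj : j ∈ T
          · rw [if_pos (hTJ j hj), Function.update_of_ne hjq, hvT i j hj, hLT _ j hj]
          · rw [if_neg (by simp [J, hjq, hj]), Function.update_of_ne hjq,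
              Function.update_of_ne hjq, hLx i j hj, hLy i j hj]
      · intro j hj
        rcases Finset.mem_insert.1 hj with h | h
        · subst h; simp [huq]
        · rw [Function.update_of_ne (hTq j h), huT i j h, hLT _ j h]
    have e3 : flipBit q P (Function.update (L (y i)) q true) = L (y i) := by
      rw [flipBit, hPu, hP', Function.update_self, Function.update_idem]
      funext j
      by_cases hjq : j = q
      · subst hjq; simp [hLy i j hqT]
      · simp [hjq]
    have e4 : W' (L (y i)) = L (y i) := by
      conv_lhs => rw [← hWq _ (hLy i q hqT)]
      rw [hW'W]
    simp only [Function.comp, e1, e2, e3, e4, hLL]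
  · intro z hz hzy
    -- the string `L z` with its bit `q` set is not moved by `W`
    have hmatch : P (L z) = true → ∀ b, W (Function.update (L z) q b) =
        Function.update (L z) q b := by
      intro hP b
      simp only [P, decide_eq_true_eq] at hP
      have key : ∀ a, (∀ j ∉ T, L a j = false) → (∀ j ∈ T, L z j = a j) →
          ∀ j ≠ q, L z j = L a j := by
        intro a ha hza j hjq
        by_cases hj : j ∈ T
        · rw [hza j hj, hLT _ j hj]
        · rw [ha j hj, hP j (by simp [J, hjq, hj])]
      have key' : ∀ a, (∀ j ∉ T, L a j = false) → (∀ j ∈ T, L z j = a j) →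
          ∀ j ≠ q, z j = a j := by
        intro a ha hza j hjq
        have h1 := key a ha hza
        by_cases hj : j ∈ T
        · rw [← hza j hj, hLT _ j hj]
        · have h2 := h1 j hjq
          have h3 := hza _ (hrepT j)
          rw [hLT _ _ (hrepT j)] at h3
          rw [hLn z j hj, hLn a j hj, h3] at h2
          exact Bool.xor_left_inj.1 h2
      refine hWfix _ fun i _ => ⟨?_, ?_⟩
      · by_contra! h
        have h1 := key' (x i) (hLx i) (fun j hj => by
          rw [← huT i j hj, ← h j (hTJ j hj), Function.update_of_ne (hTq j hj)]) (p i)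
          (hqp i)
        rw [hz _ (hpR i), hpx i] at h1
        exact Bool.false_ne_true h1
      · by_contra! h
        have h1 := key' (y i) (hLy i) fun j hj => by
          rw [← hvT i j hj, ← h j (hTJ j hj), Function.update_of_ne (hTq j hj)]
        refine hzy i (funext fun j => ?_)
        by_cases hjq : j = q
        · rw [hjq, hz q hqR, hyR i q hqR]
        · exact h1 j hjq
    have hback : ∀ w, W w = w → W' w = w := fun w hw => by
      conv_lhs => rw [← hw]
      rw [hW'W]
    have hflip : ∀ w, flipBit q P (flipBit q P w) = w := by
      intro w
      funext j
      by_cases hjq : j = q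
      · subst hjq
        rw [flipBit_self, flipBit_self]
        simp only [flipBit, hPu]
        simp
      · rw [flipBit_of_ne hjq, flipBit_of_ne hjq]
    cases hP : P (L z)
    · have e1 : flipBit q P (L z) = L z := by
        rw [flipBit, hP, Bool.xor_false, Function.update_eq_self]
      have e2 : flipBit q P (W (L z)) = W (L z) := by
        rw [flipBit, hPW, hP, Bool.xor_false, Function.update_eq_self]
      simp only [Function.comp, e1, e2, hW'W, hLL]
    · have e1 : W (flipBit q P (L z)) = flipBit q P (L z) := hmatch hP _
      have e2 : W (L z) = L z := by
        have := hmatch hP (L z q)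
        rwa [Function.update_eq_self] at this
      simp only [Function.comp, e1, hflip, hback _ e2, hLL]

end WithoutAncillas

/-! ### Sparse preparation by successive batches -/

section WithoutAncillas

variable {Q : Type} [DecidableEq Q] [Fintype Q]

theorem exists_zeroOff_finset (R : List Q) (hR : R.Nodup) :
    ∃ D : Finset (Q → Bool), (∀ x, x ∈ D ↔ ZeroOff R x) ∧ 2 ^ R.length ≤ D.card := by
  classical
  refine ⟨Finset.univ.filter (ZeroOff R), by simp, ?_⟩
  rw [← List.toFinset_card_of_nodup hR, ← Finset.card_powerset]
  refine Finset.card_le_card_of_injOn (fun s q => decide (q ∈ s)) ?_ ?_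
  · intro s hs
    simp only [Finset.coe_powerset, Set.mem_preimage, Set.mem_powerset_iff] at hs
    simp only [Finset.coe_filter, Finset.mem_univ, true_and, Set.mem_ofPred_eq]
    intro q hq
    simp only [decide_eq_false_iff_not]
    exact fun h => hq (by simpa using hs h)
  · intro s _ s' _ h
    ext q
    have := congrFun h q
    simpa using this

/-- Each batch takes up to `t` strings not yet supported on `R` to free targets. Since the targets
avoid `S`, the strings already in place are fixed, and `⌈k / t⌉` batches suffice. -/
theorem exists_hasCircuit_zeroOff (R : List Q) (hR : R.Nodup) {t : ℕ} (ht : 1 ≤ t)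
    (hcard : R.length + 4 ^ t + t + 3 ≤ Fintype.card Q) (k : ℕ) (S : Finset (Q → Bool))
    (hS : S.card ≤ 2 ^ R.length) (hk : {x ∈ S | ¬ ∀ q, q ∉ R → x q = false}.card ≤ k) :
    ∃ f, HasCircuit f
      ((k + t - 1) / t * (1402 * Fintype.card Q + 6000 * (t * (4 ^ t + 2)))) ∧
      ∀ z ∈ S, ZeroOff R (f z) := by
  classical
  induction k using Nat.strong_induction_on generalizing S with
  | _ k ih =>
  set B := {x ∈ S | ¬ ∀ q, q ∉ R → x q = false} with hB
  by_cases hB0 : B.card = 0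
  · refine ⟨_, HasCircuit.id.mono (Nat.zero_le _), fun z hz => ?_⟩
    by_contra h
    have : z ∈ B := Finset.mem_filter.2 ⟨hz, h⟩
    rw [Finset.card_eq_zero.1 hB0] at this
    simp at this
  obtain ⟨D, hD, hDcard⟩ := exists_zeroOff_finset R hR
  have hBD : B = S \ D := by
    ext z
    simp [hB, hD, ZeroOff]
  -- As `S` is no larger than `D`, there are at least as many free targets as misplaced strings.
  have hDS : B.card ≤ (D \ S).card := by
    rw [hBD]
    have h1 := Finset.card_sdiff_add_card_inter S D
    have h2 := Finset.card_sdiff_add_card_inter D S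
    rw [Finset.inter_comm] at h2
    omega
  have ht' : min t B.card ≤ B.card := min_le_right _ _
  obtain ⟨X, hXB, hX⟩ := Finset.exists_subset_card_eq ht'
  obtain ⟨Y, hYB, hY⟩ := Finset.exists_subset_card_eq (ht'.trans hDS)
  let x : Fin (min t B.card) → Q → Bool := fun i => (X.equivFinOfCardEq hX).symm i
  let y : Fin (min t B.card) → Q → Bool := fun i => (Y.equivFinOfCardEq hY).symm i
  have hx : Function.Injective x := Subtype.val_injective.comp (Equiv.injective _)
  have hy : Function.Injective y := Subtype.val_injective.comp (Equiv.injective _)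
  have hxX : ∀ z ∈ X, ∃ i, x i = z := fun z hz => ⟨X.equivFinOfCardEq hX ⟨z, hz⟩, by simp [x]⟩
  have hxm : ∀ i, x i ∈ X := fun i => ((X.equivFinOfCardEq hX).symm i).2
  have hym : ∀ i, y i ∈ Y := fun i => ((Y.equivFinOfCardEq hY).symm i).2
  have hxB : ∀ i, x i ∈ S ∧ x i ∉ D := fun i => Finset.mem_sdiff.1 (hBD ▸ hXB (hxm i))
  have hyB : ∀ i, y i ∈ D ∧ y i ∉ S := fun i => Finset.mem_sdiff.1 (hYB (hym i))
  have h4 : 4 ^ min t B.card ≤ 4 ^ t := Nat.pow_le_pow_right (by norm_num) (min_le_left _ _)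
  have hmt : min t B.card ≤ t := min_le_left _ _
  obtain ⟨g, hg, hgx, hgz⟩ := exists_hasCircuit_batch R x y hx hy
    (fun i h => (hxB i).2 ((hD _).2 h)) (fun i => (hD _).1 (hyB i).1) (by omega)
  have hg' : HasCircuit g (1402 * Fintype.card Q + 6000 * (t * (4 ^ t + 2))) :=
    hg.mono (Nat.add_le_add_left (Nat.mul_le_mul_left _
      (Nat.mul_le_mul hmt (Nat.add_le_add_right h4 2))) _)
  have hbad : {x ∈ S.image g | ¬ ∀ q, q ∉ R → x q = false}.card ≤ B.card - min t B.card := by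
    rw [← hX, ← Finset.card_sdiff_of_subset hXB]
    refine (Finset.card_le_card ?_).trans (Finset.card_image_le (f := g))
    intro w hw
    obtain ⟨hw, hwR⟩ := Finset.mem_filter.1 hw
    obtain ⟨z, hz, rfl⟩ := Finset.mem_image.1 hw
    refine Finset.mem_image_of_mem _ (Finset.mem_sdiff.2 ⟨?_, fun hzX => ?_⟩)
    · refine Finset.mem_filter.2 ⟨hz, fun hzR => ?_⟩
      refine hwR ?_
      rw [hgz z hzR (fun i h => (hyB i).2 (h ▸ hz))]
      exact hzR
    · obtain ⟨i, rfl⟩ := hxX z hzX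
      rw [hgx] at hwR
      exact hwR ((hD _).1 (hyB i).1)
  have hkt : (k - min t k + t - 1) / t + 1 ≤ (k + t - 1) / t := by
    rcases le_total t k with h | h
    · rw [min_eq_left h, ← Nat.add_div_right _ (by omega)]
      exact Nat.div_le_div_right (by omega)
    · rw [min_eq_right h, Nat.sub_self, Nat.div_eq_of_lt (by omega)]
      exact (Nat.le_div_iff_mul_le (by omega)).2 (by omega)
  obtain ⟨f, hf, hfS⟩ := ih (k - min t k) (by omega) (S.image g)
    (Finset.card_image_le.trans hS) (by omega)
  refine ⟨f ∘ g, (hf.comp hg').mono ?_, fun z hz => hfS _ (Finset.mem_image_of_mem g hz)⟩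
  refine le_trans (le_of_eq ?_) (Nat.mul_le_mul_right _ hkt)
  ring

/-- Preparation of a sparse state without spare qubits. -/
theorem exists_circuit_of_sparse (ψ : QState Q) (d : ℕ) (hψ : IsSparseState d ψ) {r t : ℕ}
    (hr : d ≤ 2 ^ r) (ht : 1 ≤ t) (hcard : r + 4 ^ t + t + 3 ≤ Fintype.card Q) :
    ∃ K : QCircuit Q, K.run (zeroState Q) = ψ ∧ K.length ≤ 6 * 2 ^ r +
      (d + t - 1) / t * (1402 * Fintype.card Q + 6000 * (t * (4 ^ t + 2))) := by
  classical
  have hne : Nonempty Q := Fintype.card_pos_iff.1 (lt_of_lt_of_le (Nat.succ_pos _) hcard)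
  obtain ⟨h1, hd⟩ := hψ
  have h4 : 0 < 4 ^ t := by positivity
  obtain ⟨R', -, hR'⟩ := Finset.exists_subset_card_eq
    (show r ≤ (Finset.univ : Finset Q).card by rw [Finset.card_univ]; omega)
  have hlen : R'.toList.length = r := by simp [hR']
  let S : Finset (Q → Bool) := {x | ψ x ≠ 0}
  have hS : S.card = d := by
    rw [← hd, ← Set.ncard_coe_finset]
    congr 1
    ext x
    simp [S]
  obtain ⟨f, hf, hfS⟩ := exists_hasCircuit_zeroOff R'.toList R'.nodup_toList ht
    (by rwa [hlen]) d S (by rwa [hlen, hS]) ((Finset.card_filter_le _ _).trans hS.le)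
  obtain ⟨K, hK, hrun⟩ := exists_circuit_of_hasCircuit R'.toList R'.nodup_toList ψ h1 hf
    fun x hx => hfS x (by simpa [S] using hx)
  exact ⟨K, hrun, by rwa [hlen] at hK⟩

/-- Preparation of an arbitrary state. -/
theorem exists_circuit_of_state [Nonempty Q] (ψ : QState Q) (h1 : ∑ x, ‖ψ x‖ ^ 2 = 1) :
    ∃ K : QCircuit Q, K.run (zeroState Q) = ψ ∧ K.length ≤ 6 * 2 ^ Fintype.card Q := by
  obtain ⟨K, hK, hrun⟩ := exists_circuit_of_zeroOff (Finset.univ : Finset Q).toList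
    (Finset.nodup_toList _) ψ (fun x _ q hq => absurd (by simp) hq) h1
  exact ⟨K, hrun, by simpa using hK⟩

end WithoutAncillas

/-! ### Renaming qubits and splitting off ancillas -/

section Relabelling

theorem zeroState_comp {Q Q' : Type} [Fintype Q] [Fintype Q'] (e : Q ≃ Q') (y : Q' → Bool) :
    zeroState Q (y ∘ e) = zeroState Q' y := by
  have : (∀ q, (y ∘ e) q = false) ↔ ∀ q, y q = false :=
    ⟨fun h q => by simpa using h (e.symm q), fun h q => h (e q)⟩
  simp only [zeroState, this]

theorem exists_circuit_relabel {Q Q' : Type} [DecidableEq Q] [DecidableEq Q'] [Fintype Q]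
    [Fintype Q'] (e : Q ≃ Q') (ψ : QState Q) (K : QCircuit Q) (hK : K.run (zeroState Q) = ψ) :
    ∃ K' : QCircuit Q', K'.length = K.length ∧
      K'.run (zeroState Q') = fun y => ψ (y ∘ e) := by
  refine ⟨K.map (ElemGate.relabel e), by simp, ?_⟩
  have h := QCircuit.run_relabel e K (zeroState Q)
  simp only [zeroState_comp] at h
  rw [h, hK]

theorem exists_prepares_zero {n : ℕ} {ψ : QState (Fin n)} (K : QCircuit (Fin n))
    (hK : K.run (zeroState (Fin n)) = ψ) :
    ∃ K' : QCircuit (Fin n ⊕ Fin 0), Prepares K' ψ ∧ K'.length = K.length := by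
  obtain ⟨K', hlen, hrun⟩ := exists_circuit_relabel (Equiv.sumEmpty (Fin n) (Fin 0)).symm ψ K hK
  refine ⟨K', ?_, hlen⟩
  rw [Prepares, hrun]
  funext y
  simp [withZeroAncillas, zeroState, Function.comp_def]

theorem sum_norm_withZeroAncillas {n : ℕ} (m : ℕ) (ψ : QState (Fin n)) :
    ∑ y, ‖withZeroAncillas m ψ y‖ ^ 2 = ∑ x, ‖ψ x‖ ^ 2 := by
  rw [← Equiv.sum_comp (Equiv.sumArrowEquivProdArrow (Fin n) (Fin m) Bool).symm,
    Fintype.sum_prod_type]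
  refine Finset.sum_congr rfl fun x _ => ?_
  rw [Finset.sum_eq_single (fun _ => false)]
  · simp [withZeroAncillas, zeroState, Equiv.sumArrowEquivProdArrow]
  · intro y _ hy
    have : ¬ ∀ q, y q = false := fun h => hy (funext h)
    have h0 : zeroState (Fin m) y = 0 := if_neg this
    change ‖ψ x * zeroState (Fin m) y‖ ^ 2 = 0
    simp [h0]
  · simp

end Relabelling

/-! ### Unary encoding of blocks, with ancillas -/

section BlockCode

variable {B t : ℕ}

/-- A register consisting of `B` blocks of `t` data qubits, of `2 ^ t` qubits for each block that
encode the content of this block in unary, and of two spare qubits. -/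
abbrev CodeRegister (B t : ℕ) : Type :=
  (Fin B × Fin t) ⊕ ((Fin B × (Fin t → Bool)) ⊕ Fin 2)

/-- The content of the register before encoding the data `X`. -/
def dataString (X : Fin B × Fin t → Bool) : CodeRegister B t → Bool :=
  Sum.elim X (Sum.elim (fun _ => false) fun _ => false)

/-- The content of the register after encoding the data `X`. -/
def codeString (X : Fin B × Fin t → Bool) : CodeRegister B t → Bool :=
  Sum.elim (fun _ => false)
    (Sum.elim (fun p => decide (∀ i, X (p.1, i) = p.2 i)) fun _ => false)

theorem card_codeRegister : Fintype.card (CodeRegister B t) = B * t + (B * 2 ^ t + 2) := by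
  simp

/-- Each unary qubit is computed from its block by a pattern test. Each data bit is then erased by
adding the parity of the unary qubits whose pattern has a 1 in its position: only the qubit of the
actual content is set, so this parity equals the data bit. -/
theorem exists_hasCircuit_encode : ∃ E : (CodeRegister B t → Bool) → CodeRegister B t → Bool,
    HasCircuit E (B * t * 2 ^ t + B * 2 ^ t * (700 * (t + 1))) ∧
      ∀ X, E (dataString X) = codeString X := by
  let J₁ : Finset (CodeRegister B t) := Finset.univ.image fun p => Sum.inr (Sum.inl p)
  let J₂ : Finset (CodeRegister B t) := Finset.univ.image Sum.inl
  let p₁ : CodeRegister B t → (CodeRegister B t → Bool) → Bool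
    | .inr (.inl p), x => decide (∀ i, x (.inl (p.1, i)) = p.2 i)
    | _, _ => false
  let p₂ : CodeRegister B t → (CodeRegister B t → Bool) → Bool
    | .inl k, x => decide (Odd (Finset.card {p ∈ ({p | p k.2 = true} : Finset (Fin t → Bool)) |
        x (.inr (.inl (k.1, p))) = true}))
    | _, _ => false
  have h₁ : HasCircuit (flipBits J₁ p₁) (B * 2 ^ t * (700 * (t + 1))) := by
    have hJ : J₁.card = B * 2 ^ t := by
      refine (Finset.card_image_of_injective _ fun p p' h => by simpa using h).trans ?_
      simp
    rw [← hJ]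
    refine hasCircuit_flipBits ?_ ?_
    · intro j hj
      obtain ⟨⟨b, p⟩, -, rfl⟩ := Finset.mem_image.1 hj
      let C : Finset (CodeRegister B t) := Finset.univ.image fun i => Sum.inl (b, i)
      have hC : C.card = t := by
        rw [Finset.card_image_of_injective _ fun i i' h => by simpa using h]
        simp
      have hB : 1 ≤ B := b.pos
      have h := hasCircuit_matches C (fun q => Sum.elim (fun k => p k.2) (fun _ => false) q)
        (Sum.inr (Sum.inl (b, p))) (by simp [C]) (by
          rw [card_codeRegister, hC]
          have : 1 * t ≤ B * t := Nat.mul_le_mul_right t hB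
          omega)
      rw [hC] at h
      convert h using 2
      funext x
      simp [p₁, C]
    · intro j hj x y h
      obtain ⟨⟨b, p⟩, -, rfl⟩ := Finset.mem_image.1 hj
      have : ∀ i, x (.inl (b, i)) = y (.inl (b, i)) := fun i => h _ (by simp [J₁])
      simp only [p₁, this]
  have h₂ : HasCircuit (flipBits J₂ p₂) (B * t * 2 ^ t) := by
    have hJ : J₂.card = B * t := by
      rw [Finset.card_image_of_injective _ Sum.inl_injective]
      simp
    rw [← hJ]
    refine hasCircuit_flipBits ?_ ?_
    · intro j hj
      obtain ⟨⟨b, i⟩, -, rfl⟩ := Finset.mem_image.1 hj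
      refine (hasCircuit_flipBit_sum ({p | p i = true} : Finset (Fin t → Bool))
        (fun p => Sum.inr (Sum.inl (b, p))) (by simp) _ fun x => rfl).mono ?_
      refine (Finset.card_le_univ _).trans ?_
      simp
    · intro j hj x y h
      obtain ⟨⟨b, i⟩, -, rfl⟩ := Finset.mem_image.1 hj
      have : ∀ p, x (.inr (.inl (b, p))) = y (.inr (.inl (b, p))) := fun p =>
        h _ (by simp [J₂])
      simp only [p₂, this]
  refine ⟨flipBits J₂ p₂ ∘ flipBits J₁ p₁, h₂.comp h₁, fun X => ?_⟩
  have e₁ : flipBits J₁ p₁ (dataString X) =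
      Sum.elim X (Sum.elim (fun p => decide (∀ i, X (p.1, i) = p.2 i)) fun _ => false) := by
    funext j
    rcases j with k | p | s
    · simp [flipBits, J₁, dataString]
    · simp [flipBits, J₁, dataString, p₁]
      congr
    · simp [flipBits, J₁, dataString]
  rw [Function.comp, e₁]
  funext j
  rcases j with ⟨b, i⟩ | p | s
  · have hodd : Odd (Finset.card {p ∈ ({p | p i = true} : Finset (Fin t → Bool)) |
        ∀ i, X (b, i) = p i}) ↔ X (b, i) = true := by
      cases hX : X (b, i)
      · rw [Finset.card_eq_zero.2]
        · simp
        · refine Finset.filter_eq_empty_iff.2 fun p hp h => ?_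
          rw [h i, (Finset.mem_filter.1 hp).2] at hX
          exact Bool.false_ne_true hX.symm
      · rw [Finset.card_eq_one.2 ⟨fun i => X (b, i), ?_⟩]
        · simp
        · ext p
          simp only [Finset.mem_filter, Finset.mem_univ, true_and, Finset.mem_singleton]
          constructor
          · exact fun h => funext fun i => (h.2 i).symm
          · rintro rfl
            exact ⟨hX, fun _ => rfl⟩
    have : p₂ (.inl (b, i)) (Sum.elim X
        (Sum.elim (fun p => decide (∀ i, X (p.1, i) = p.2 i)) fun _ => false)) = X (b, i) := by
      simp only [p₂, Sum.elim_inr, Sum.elim_inl, decide_eq_true_eq, hodd]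
      cases X (b, i) <;> rfl
    rw [flipBits, if_pos (by simp [J₂]), this]
    simp [codeString]
  · simp [flipBits, J₂, codeString]
  · simp [flipBits, J₂, codeString]

/-- Only the qubits in `J`, where one of the two code words has a 1, need to be inspected: a code
word containing all ones of `x` must be that of `x`, since the ones determine every block. This
makes the cost proportional to the number of blocks instead of the number of qubits. -/
theorem exists_hasCircuit_swap_codes (ht : 1 ≤ t) (x y : Fin B × Fin t → Bool) (hxy : x ≠ y) :
    ∃ G, HasCircuit G (3000 * (2 * B + 1)) ∧
      ∀ X, G (codeString X) = codeString (Equiv.swap x y X) := by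
  classical
  let J : Finset (CodeRegister B t) :=
    (Finset.univ.image fun b => Sum.inr (Sum.inl (b, fun i => x (b, i)))) ∪
      Finset.univ.image fun b => Sum.inr (Sum.inl (b, fun i => y (b, i)))
  have hJ : J.card ≤ 2 * B := by
    refine (Finset.card_union_le _ _).trans ?_
    rw [two_mul]
    exact Nat.add_le_add (Finset.card_image_le.trans (by simp))
      (Finset.card_image_le.trans (by simp))
  have h2 : 2 ^ 1 ≤ 2 ^ t := Nat.pow_le_pow_right (by norm_num) ht
  have h3 : B * 2 ≤ B * 2 ^ t := Nat.mul_le_mul_left B (by simpa using h2)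
  have hmx : ∀ X : Fin B × Fin t → Bool, (∀ j ∈ J, codeString X j = codeString x j) → X = x := by
    intro X h
    funext ⟨b, i⟩
    have := h (.inr (.inl (b, fun i => x (b, i)))) (by simp [J])
    simp only [codeString, Sum.elim_inr, Sum.elim_inl, implies_true, decide_true,
      decide_eq_true_eq] at this
    exact this i
  have hmy : ∀ X : Fin B × Fin t → Bool, (∀ j ∈ J, codeString X j = codeString y j) → X = y := by
    intro X h
    funext ⟨b, i⟩
    have := h (.inr (.inl (b, fun i => y (b, i)))) (by simp [J])
    simp only [codeString, Sum.elim_inr, Sum.elim_inl, implies_true, decide_true,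
      decide_eq_true_eq] at this
    exact this i
  have hoff : ∀ j ∉ J, codeString x j = false ∧ codeString y j = false := by
    intro j hj
    rcases j with k | ⟨b, p⟩ | s
    · simp [codeString]
    · simp only [codeString, Sum.elim_inr, Sum.elim_inl, decide_eq_false_iff_not]
      constructor
      · intro h
        exact hj (Finset.mem_union_left _ (Finset.mem_image.2 ⟨b, Finset.mem_univ b, by
          rw [funext h]⟩))
      · intro h
        exact hj (Finset.mem_union_right _ (Finset.mem_image.2 ⟨b, Finset.mem_univ b, by
          rw [funext h]⟩))
    · simp [codeString]
  have hne : ∃ j ∈ J, codeString x j ≠ codeString y j := by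
    by_contra! h
    exact hxy (hmy x h)
  refine ⟨swapPattern J (codeString x) (codeString y),
    (hasCircuit_swapPattern J _ _ (by rw [card_codeRegister]; omega)).mono (by omega), ?_⟩
  intro X
  by_cases hX : X = x
  · subst hX
    rw [Equiv.swap_apply_left, swapPattern_of_eq (fun _ _ => rfl) hne]
    funext j
    split_ifs with hj
    · rfl
    · rw [(hoff j hj).1, (hoff j hj).2]
  · by_cases hY : X = y
    · subst hY
      rw [Equiv.swap_apply_right, swapPattern_of_eq' (fun _ _ => rfl) hne]
      funext j
      split_ifs with hj
      · rfl
      · rw [(hoff j hj).1, (hoff j hj).2]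
    · rw [Equiv.swap_apply_of_ne_of_ne hX hY, swapPattern_of_ne]
      · by_contra! h
        exact hX (hmx X h)
      · by_contra! h
        exact hY (hmy X h)

/-- Each transposition exchanges a misplaced string with a free element of `D`, which lowers the
number of misplaced strings by one. -/
theorem exists_hasCircuit_move_codes (ht : 1 ≤ t) (D : Finset (Fin B × Fin t → Bool)) (k : ℕ)
    (S : Finset (Fin B × Fin t → Bool)) (hSD : S.card ≤ D.card) (hk : (S \ D).card ≤ k) :
    ∃ G, HasCircuit G (k * (3000 * (2 * B + 1))) ∧
      ∃ σ : (Fin B × Fin t → Bool) → Fin B × Fin t → Bool, (∀ X, G (codeString X) = codeString (σ X)) ∧ ∀ X ∈ S, σ X ∈ D := by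
  classical
  induction k generalizing S with
  | zero =>
    refine ⟨_, HasCircuit.id.mono (Nat.zero_le _), fun X => X, fun X => rfl, fun X hX => ?_⟩
    exact Finset.sdiff_eq_empty_iff_subset.1 (Finset.card_eq_zero.1 (Nat.le_zero.1 hk)) hX
  | succ k ih =>
    by_cases h0 : (S \ D).card ≤ k
    · obtain ⟨G, hG, h⟩ := ih S hSD h0
      exact ⟨G, hG.mono (Nat.mul_le_mul_right _ (Nat.le_succ k)), h⟩
    have hDS : (S \ D).card ≤ (D \ S).card := by
      have h1 := Finset.card_sdiff_add_card_inter S D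
      have h2 := Finset.card_sdiff_add_card_inter D S
      rw [Finset.inter_comm] at h2
      omega
    obtain ⟨x, hx⟩ := Finset.card_pos.1 (show 0 < (S \ D).card by omega)
    obtain ⟨y, hy⟩ := Finset.card_pos.1 (show 0 < (D \ S).card by omega)
    obtain ⟨hxS, hxD⟩ := Finset.mem_sdiff.1 hx
    obtain ⟨hyD, hyS⟩ := Finset.mem_sdiff.1 hy
    obtain ⟨G', hG', hcode⟩ := exists_hasCircuit_swap_codes ht x y fun h => hxD (h ▸ hyD)
    have hbad : (S.image (Equiv.swap x y) \ D).card ≤ k := by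
      have : S.image (Equiv.swap x y) \ D ⊆ (S \ D).erase x := by
        intro w hw
        obtain ⟨hw, hwD⟩ := Finset.mem_sdiff.1 hw
        obtain ⟨z, hz, rfl⟩ := Finset.mem_image.1 hw
        have hzy : z ≠ y := fun h => hyS (h ▸ hz)
        by_cases hzx : z = x
        · rw [hzx, Equiv.swap_apply_left] at hwD
          exact absurd hyD hwD
        · rw [Equiv.swap_apply_of_ne_of_ne hzx hzy] at hwD ⊢
          simp [hzx, hz, hwD]
      refine (Finset.card_le_card this).trans ?_
      rw [Finset.card_erase_of_mem hx]
      omega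
    obtain ⟨G, hG, σ, hσ, hS⟩ := ih (S.image (Equiv.swap x y)) (Finset.card_image_le.trans hSD) hbad
    refine ⟨G ∘ G', (hG.comp hG').mono (by rw [add_mul, one_mul]), σ ∘ Equiv.swap x y,
      fun X => ?_, fun X hX => hS _ (Finset.mem_image_of_mem _ hX)⟩
    rw [Function.comp, hcode, hσ]
    rfl

/-- Preparation of a sparse state with the help of a unary encoding of blocks of qubits. -/
theorem exists_prepares_of_blocks {n d r : ℕ} (ψ : QState (Fin n)) (hψ : IsSparseState d ψ)
    (ht : 1 ≤ t) (hn : n ≤ B * t) (hr : d ≤ 2 ^ r) (hrB : r ≤ B * t) :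
    ∃ (m : ℕ) (K : QCircuit (Fin n ⊕ Fin m)), Prepares K ψ ∧ K.length ≤ 6 * 2 ^ r +
      (2 * (B * t * 2 ^ t + B * 2 ^ t * (700 * (t + 1))) + d * (3000 * (2 * B + 1))) := by
  classical
  let ι : Fin n → Fin B × Fin t := finProdFinEquiv.symm ∘ Fin.castLE hn
  have hι : Function.Injective ι :=
    finProdFinEquiv.symm.injective.comp (Fin.castLE_injective hn)
  let F : Fin n → CodeRegister B t := Sum.inl ∘ ι
  have hF : Function.Injective F := Sum.inl_injective.comp hι
  -- Every qubit of the code register that is not the place of a data qubit serves as an ancilla,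
  -- including padding in the blocks.
  let m := Fintype.card ↥(Set.range F)ᶜ
  let e : Fin n ⊕ Fin m ≃ CodeRegister B t :=
    (Equiv.sumCongr (Equiv.ofInjective F hF) (Fintype.equivFin _).symm).trans
      (Equiv.Set.sumCompl (Set.range F))
  have he : ∀ i, e (.inl i) = .inl (ι i) := fun i => rfl
  have hecompl : ∀ q, q ∉ Set.range F → ∃ j, e (.inr j) = q := by
    intro q hq
    rcases h : e.symm q with i | j
    · exact absurd ⟨i, by rw [← e.apply_symm_apply q, h, he]; rfl⟩ hq
    · exact ⟨j, by rw [← h, e.apply_symm_apply]⟩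
  let Ψ : QState (CodeRegister B t) := fun z => withZeroAncillas m ψ (z ∘ e)
  have hΨ1 : ∑ z, ‖Ψ z‖ ^ 2 = 1 := by
    rw [← hψ.1, ← sum_norm_withZeroAncillas m ψ]
    exact Equiv.sum_comp (Equiv.arrowCongr e.symm (Equiv.refl Bool))
      fun y => ‖withZeroAncillas m ψ y‖ ^ 2
  let S : Finset (Fin B × Fin t → Bool) :=
    ({w | ψ w ≠ 0} : Finset (Fin n → Bool)).image fun w => Function.extend ι w fun _ => false
  have hScard : S.card ≤ d := by
    refine Finset.card_image_le.trans (le_of_eq ?_)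
    rw [← hψ.2, ← Set.ncard_coe_finset]
    congr 1
    ext x
    simp
  have hΨS : ∀ z, Ψ z ≠ 0 → ∃ X ∈ S, z = dataString X := by
    intro z hz
    have h1 : ψ (fun i => z (e (.inl i))) ≠ 0 := left_ne_zero_of_mul hz
    have h2 : zeroState (Fin m) (fun j => z (e (.inr j))) ≠ 0 := right_ne_zero_of_mul hz
    have h3 : ∀ j, z (e (.inr j)) = false := by
      by_contra h
      exact h2 (if_neg h)
    have h4 : ∀ q, q ∉ Set.range F → z q = false := fun q hq => by
      obtain ⟨j, rfl⟩ := hecompl q hq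
      exact h3 j
    refine ⟨fun k => z (.inl k), Finset.mem_image.2 ⟨fun i => z (e (.inl i)), by simpa using h1,
      ?_⟩, ?_⟩
    · funext k
      by_cases hk : ∃ i, ι i = k
      · obtain ⟨i, rfl⟩ := hk
        rw [hι.extend_apply, he]
      · rw [Function.extend_apply' _ _ _ hk]
        refine (h4 _ ?_).symm
        rintro ⟨i, hi⟩
        exact hk ⟨i, Sum.inl_injective hi⟩
    · funext q
      rcases q with k | p | s
      · rfl
      · exact h4 _ (by simp [F])
      · exact h4 _ (by simp [F])
  obtain ⟨R', -, hR'⟩ := Finset.exists_subset_card_eq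
    (show r ≤ (Finset.univ : Finset (Fin B × Fin t)).card by simpa using hrB)
  have hlen : R'.toList.length = r := by simp [hR']
  obtain ⟨D, hD, hDcard⟩ := exists_zeroOff_finset R'.toList R'.nodup_toList
  rw [hlen] at hDcard
  obtain ⟨E, hE, hEcode⟩ := exists_hasCircuit_encode (B := B) (t := t)
  obtain ⟨E', hE', hE'E, -⟩ := hE.exists_inverse
  obtain ⟨G, hG, σ, hσ, hσS⟩ := exists_hasCircuit_move_codes ht D d S
    (hScard.trans (hr.trans hDcard)) ((Finset.card_le_card Finset.sdiff_subset).trans hScard)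
  let R : List (CodeRegister B t) := R'.toList.map Sum.inl
  have hR : R.Nodup := R'.nodup_toList.map Sum.inl_injective
  have : Nonempty (CodeRegister B t) := ⟨.inr (.inr 0)⟩
  -- Encoding, permuting the code words and decoding replaces the data `X` by `σ X` and returns the
  -- ancillas to zero.
  obtain ⟨K, hK, hrun⟩ := exists_circuit_of_hasCircuit R hR Ψ hΨ1 (hE'.comp (hG.comp hE)) (by
    intro z hz
    obtain ⟨X, hX, rfl⟩ := hΨS z hz
    simp only [Function.comp, hEcode, hσ]
    rw [← hEcode, hE'E]
    have h := (hD _).1 (hσS X hX)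
    intro q hq
    rcases q with k | p | s
    · exact h k fun hk => hq (List.mem_map_of_mem hk)
    · rfl
    · rfl)
  obtain ⟨K', hlen', hrun'⟩ := exists_circuit_relabel e.symm Ψ K hrun
  refine ⟨m, K', ?_, ?_⟩
  · rw [Prepares, hrun']
    funext y
    simp only [Ψ]
    congr 1
    funext q
    simp
  · rw [hlen']
    refine hK.trans ?_
    rw [List.length_map, hlen]
    omega

end BlockCode

/-! ### Untouched qubits and the linear lower bound -/

section Touched

variable {Q : Type} [DecidableEq Q]

/-- The qubits a gate acts on. -/
def ElemGate.qubits : ElemGate Q → Finset Q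
  | .single q _ => {q}
  | .cnot c t _ => {c, t}

/-- The qubits a circuit acts on. -/
def QCircuit.qubits : QCircuit Q → Finset Q
  | [] => ∅
  | g :: K => g.qubits ∪ QCircuit.qubits K

theorem QCircuit.card_qubits_le (K : QCircuit Q) : K.qubits.card ≤ 2 * K.length := by
  induction K with
  | nil => simp [QCircuit.qubits]
  | cons g K ih =>
    have hg : g.qubits.card ≤ 2 := by
      cases g with
      | single q U => simp [ElemGate.qubits]
      | cnot c t h => exact Finset.card_le_two
    refine (Finset.card_union_le _ _).trans ?_
    rw [List.length_cons]
    change (QCircuit.qubits K).card ≤ 2 * K.length at ih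
    omega

theorem ElemGate.apply_eq_zero {g : ElemGate Q} {q : Q} (hq : q ∉ g.qubits) {ψ : QState Q}
    (hψ : ∀ x, x q = true → ψ x = 0) (x : Q → Bool) (hx : x q = true) : g.apply ψ x = 0 := by
  cases g with
  | single p U =>
    have hqp : q ≠ p := by simpa [ElemGate.qubits] using hq
    rw [ElemGate.apply_single, hψ _ (by rwa [Function.update_of_ne hqp]),
      hψ _ (by rwa [Function.update_of_ne hqp])]
    simp
  | cnot c t h =>
    have hqt : q ≠ t := fun e => hq (by simp [ElemGate.qubits, e])
    rw [ElemGate.apply_cnot, hψ _ (by rwa [Function.update_of_ne hqt])]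

theorem QCircuit.run_eq_zero {K : QCircuit Q} {q : Q} (hq : q ∉ K.qubits) {ψ : QState Q}
    (hψ : ∀ x, x q = true → ψ x = 0) (x : Q → Bool) (hx : x q = true) : K.run ψ x = 0 := by
  induction K generalizing ψ with
  | nil => exact hψ x hx
  | cons g K ih =>
    simp only [QCircuit.qubits, Finset.mem_union, not_or] at hq
    exact ih hq.2 (ElemGate.apply_eq_zero hq.1 hψ)

theorem Prepares.run_sumElim {n m : ℕ} {K : QCircuit (Fin n ⊕ Fin m)} {ψ : QState (Fin n)}
    (h : Prepares K ψ) (x : Fin n → Bool) :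
    K.run (zeroState _) (Sum.elim x fun _ => false) = ψ x := by
  rw [h]
  simp [withZeroAncillas, zeroState]

/-- Each qubit has to be touched if the basis state with all bits set has to be reached. -/
theorem Prepares.le_two_mul_size {n m : ℕ} {K : QCircuit (Fin n ⊕ Fin m)} {ψ : QState (Fin n)}
    (h : Prepares K ψ) (hψ : ψ (fun _ => true) ≠ 0) : n ≤ 2 * K.length := by
  refine le_trans ?_ K.card_qubits_le
  have : (Finset.univ.image Sum.inl : Finset (Fin n ⊕ Fin m)) ⊆ K.qubits := by
    intro q hq
    obtain ⟨i, -, rfl⟩ := Finset.mem_image.1 hq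
    by_contra hi
    refine hψ ?_
    rw [← h.run_sumElim]
    refine QCircuit.run_eq_zero hi (fun x hx => ?_) _ rfl
    refine if_neg fun h0 => ?_
    rw [h0] at hx
    exact Bool.false_ne_true hx
  refine le_trans (le_of_eq ?_) (Finset.card_le_card this)
  rw [Finset.card_image_of_injective _ Sum.inl_injective]
  simp

end Touched

/-! ### Amplitudes as polynomials in the gate entries -/

section Symbolic

variable {Q : Type} [DecidableEq Q] {A A' : Type} [CommSemiring A] [CommSemiring A']

/-- The action of a gate with entries in a commutative semiring: a pair of equal qubits stands for
a one-qubit gate, a pair of different ones for a CNOT gate. -/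
def symbolicStep (ψ : (Q → Bool) → A) (g : (Q × Q) × (Bool → Bool → A)) (x : Q → Bool) : A :=
  if g.1.1 = g.1.2 then
    g.2 (x g.1.1) false * ψ (Function.update x g.1.1 false) +
      g.2 (x g.1.1) true * ψ (Function.update x g.1.1 true)
  else ψ (Function.update x g.1.2 (xor (x g.1.2) (x g.1.1)))

/-- The action of a sequence of gates with entries in a commutative semiring. -/
def symbolicRun (K : List ((Q × Q) × (Bool → Bool → A))) (ψ : (Q → Bool) → A) :
    (Q → Bool) → A := K.foldl symbolicStep ψ

theorem symbolicRun_map (φ : A →+* A') (K : List ((Q × Q) × (Bool → Bool → A)))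
    (ψ : (Q → Bool) → A) (x : Q → Bool) : φ (symbolicRun K ψ x) =
      symbolicRun (K.map fun g => (g.1, fun a b => φ (g.2 a b))) (fun y => φ (ψ y)) x := by
  induction K generalizing ψ with
  | nil => rfl
  | cons g K ih =>
    change φ (symbolicRun K (symbolicStep ψ g) x) = _
    rw [ih]
    change symbolicRun _ _ x = symbolicRun _ (symbolicStep (fun y => φ (ψ y)) _) x
    congr 1
    funext y
    simp only [symbolicStep]
    split_ifs <;> simp

theorem degreeOf_symbolicRun {σ : Type} (v : σ)
    (K : List ((Q × Q) × (Bool → Bool → MvPolynomial σ ℂ)))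
    (hK : ∀ g ∈ K, ∀ a b, (g.2 a b).degreeOf v ≤ 1) (ψ : (Q → Bool) → MvPolynomial σ ℂ) (k : ℕ)
    (hψ : ∀ x, (ψ x).degreeOf v ≤ k) (x : Q → Bool) :
    (symbolicRun K ψ x).degreeOf v ≤ k + K.length := by
  induction K generalizing ψ k with
  | nil => exact hψ x
  | cons g K ih =>
    have hg := hK g (by simp)
    have := ih (fun g hg => hK g (by simp [hg])) (symbolicStep ψ g) (k + 1) (fun y => by
      simp only [symbolicStep]
      split_ifs
      · refine (MvPolynomial.degreeOf_add_le _ _ _).trans (max_le ?_ ?_) <;>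
          refine (MvPolynomial.degreeOf_mul_le _ _ _).trans ?_ <;>
          rw [add_comm] <;> exact Nat.add_le_add (hψ _) (hg _ _)
      · exact (hψ _).trans (Nat.le_succ k))
    rw [List.length_cons, add_comm K.length, ← add_assoc]
    exact this

/-- The relabelled gate, in symbolic form. -/
def ElemGate.toSymbolic {Q' : Type} (ι : Q → Q') : ElemGate Q → (Q' × Q') × (Bool → Bool → ℂ)
  | .single q U => ((ι q, ι q), (U : Matrix Bool Bool ℂ))
  | .cnot c t _ => ((ι c, ι t), 1)

/-- Qubits outside `U` are never acted on, so `ι` need only be injective on `U`. This allows an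
unbounded number of ancillas to be compressed into a register whose size depends on the circuit
size. -/
theorem symbolicRun_toSymbolic {Q' : Type} [DecidableEq Q'] (ι : Q → Q') (U : Finset Q)
    (hι : Set.InjOn ι U) (K : QCircuit Q) (hK : K.qubits ⊆ U) (ψ : QState Q) (ψ' : QState Q')
    (hψ : ∀ y : Q' → Bool, (∀ p ∉ U.image ι, y p = false) →
      ψ' y = ψ fun q => if q ∈ U then y (ι q) else false)
    (y : Q' → Bool) (hy : ∀ p ∉ U.image ι, y p = false) :
    symbolicRun (K.map (ElemGate.toSymbolic ι)) ψ' y =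
      K.run ψ fun q => if q ∈ U then y (ι q) else false := by
  have hupd : ∀ (y : Q' → Bool) (q : Q) (b : Bool), q ∈ U →
      (fun j => if j ∈ U then Function.update y (ι q) b (ι j) else false) =
        Function.update (fun j => if j ∈ U then y (ι j) else false) q b := by
    intro y q b hq
    funext j
    by_cases hjq : j = q
    · subst hjq; simp [hq]
    · by_cases hj : j ∈ U
      · have : ι j ≠ ι q := fun h => hjq (hι hj hq h)
        simp [hjq, hj, this]
      · simp [hjq, hj]
  have hoff : ∀ (y : Q' → Bool) (q : Q) (b : Bool), q ∈ U → (∀ p ∉ U.image ι, y p = false) →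
      ∀ p ∉ U.image ι, Function.update y (ι q) b p = false := by
    intro y q b hq hy p hp
    have : p ≠ ι q := fun h => hp (h ▸ Finset.mem_image_of_mem ι hq)
    rw [Function.update_of_ne this]
    exact hy p hp
  induction K generalizing ψ ψ' with
  | nil => exact hψ y hy
  | cons g K ih =>
    have hKU : QCircuit.qubits K ⊆ U := Finset.union_subset_right hK
    have hgU : g.qubits ⊆ U := Finset.union_subset_left hK
    refine ih hKU (g.apply ψ) (symbolicStep ψ' (g.toSymbolic ι)) fun y hy => ?_
    cases g with
    | single q V =>
      have hq : q ∈ U := hgU (by simp [ElemGate.qubits])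
      simp only [ElemGate.toSymbolic, symbolicStep, if_true, ElemGate.apply_single]
      rw [hψ _ (hoff y q _ hq hy), hψ _ (hoff y q _ hq hy), hupd y q _ hq, hupd y q _ hq,
        if_pos hq]
    | cnot c t h =>
      have hc : c ∈ U := hgU (by simp [ElemGate.qubits])
      have ht : t ∈ U := hgU (by simp [ElemGate.qubits])
      have hct : ι c ≠ ι t := fun e => h (hι hc ht e)
      have hstep : symbolicStep ψ' (ElemGate.toSymbolic ι (.cnot c t h)) y =
          ψ' (Function.update y (ι t) (xor (y (ι t)) (y (ι c)))) := if_neg hct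
      rw [hstep, ElemGate.apply_cnot, hψ _ (hoff y t _ ht hy), hupd y t _ ht, if_pos hc, if_pos ht]

/-- The amplitudes produced by a circuit with gates at the positions `τ`, as polynomials in the
entries of its gates. -/
noncomputable def amplitudePoly [Fintype Q] {s : ℕ} (τ : Fin s → Q × Q) (x : Q → Bool) :
    MvPolynomial (Fin s × Bool × Bool) ℂ :=
  symbolicRun ((List.finRange s).map fun i => (τ i, fun a b => MvPolynomial.X (i, a, b)))
    (fun y => MvPolynomial.C (zeroState Q y)) x

theorem degreeOf_amplitudePoly [Fintype Q] {s : ℕ} (τ : Fin s → Q × Q) (x : Q → Bool)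
    (v : Fin s × Bool × Bool) : (amplitudePoly τ x).degreeOf v ≤ s := by
  have := degreeOf_symbolicRun v
    ((List.finRange s).map fun i =>
      (τ i, fun a b => (MvPolynomial.X (i, a, b) : MvPolynomial (Fin s × Bool × Bool) ℂ)))
    (fun g hg a b => by
      obtain ⟨i, -, rfl⟩ := List.mem_map.1 hg
      simp only [MvPolynomial.degreeOf_X]
      split_ifs <;> simp)
    (fun y => MvPolynomial.C (zeroState Q y)) 0 (fun y => by simp [MvPolynomial.degreeOf_C]) x
  simpa [amplitudePoly] using this

/-- The states prepared by circuits of size `s` are values of finitely many polynomial maps. -/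
theorem Prepares.exists_eval_amplitudePoly {n m s : ℕ} (hn : 1 ≤ n)
    {K : QCircuit (Fin n ⊕ Fin m)} {ψ : QState (Fin n)} (h : Prepares K ψ) (hs : K.length ≤ s) :
    ∃ (τ : Fin s → (Fin n ⊕ Fin (2 * s + 1)) × (Fin n ⊕ Fin (2 * s + 1)))
      (u : Fin s × Bool × Bool → ℂ),
      ∀ x, MvPolynomial.eval u (amplitudePoly τ (Sum.elim x fun _ => false)) = ψ x := by
  -- Identity gates pad the circuit to exactly `s` gates; they need a qubit, whence `1 ≤ n`.
  obtain ⟨L, hL, hrun⟩ : ∃ L : QCircuit (Fin n ⊕ Fin m), L.length = s ∧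
      ∀ φ, L.run φ = K.run φ := by
    refine ⟨K ++ List.replicate (s - K.length) (.single (.inl ⟨0, hn⟩) 1), by simp [hs],
      fun φ => ?_⟩
    rw [QCircuit.run_append]
    generalize s - K.length = k
    induction k with
    | zero => rfl
    | succ k ih => rw [List.replicate_succ, QCircuit.run_cons, apply_single_one, ih]
  subst hL
  let V : Finset (Fin m) := {j | Sum.inr j ∈ L.qubits}
  have hV : V.card ≤ Fintype.card (Fin (2 * L.length + 1)) := by
    have h1 : (V.image Sum.inr).card = V.card :=
      Finset.card_image_of_injective V (Sum.inr_injective (α := Fin n))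
    have h2 : V.image Sum.inr ⊆ L.qubits := by
      intro q hq
      obtain ⟨j, hj, rfl⟩ := Finset.mem_image.1 hq
      simpa [V] using hj
    have := (Finset.card_le_card h2).trans L.card_qubits_le
    rw [Fintype.card_fin]
    omega
  obtain ⟨α⟩ : Nonempty (V ↪ Fin (2 * L.length + 1)) :=
    Function.Embedding.nonempty_of_card_le (by rwa [Fintype.card_coe])
  -- Untouched ancillas go to the default `0`, which may collide with a touched one but lies outside
  -- the set where injectivity matters. The extra `1` makes a default available even for the empty
  -- circuit.
  let β : Fin m → Fin (2 * L.length + 1) := fun j => if hj : j ∈ V then α ⟨j, hj⟩ else 0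
  have hβ : ∀ i ∈ V, ∀ j ∈ V, β i = β j → i = j := by
    intro i hi j hj hij
    simp only [β, hi, hj, dif_pos] at hij
    simpa using α.injective hij
  let ι : Fin n ⊕ Fin m → Fin n ⊕ Fin (2 * L.length + 1) := Sum.map id β
  let U : Finset (Fin n ⊕ Fin m) := Finset.univ.image Sum.inl ∪ L.qubits
  have hUl : ∀ i : Fin n, Sum.inl i ∈ U := fun i => Finset.mem_union_left _ (by simp)
  have hUr : ∀ j : Fin m, Sum.inr j ∈ U → j ∈ V := fun j hj => by simpa [U, V] using hj
  have hι : Set.InjOn ι U := by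
    rintro (i | i) hi (j | j) hj hij
    · simpa [ι] using hij
    · simp [ι] at hij
    · simp [ι] at hij
    · simp only [ι, Sum.map_inr, Sum.inr.injEq] at hij
      rw [hβ i (hUr i hi) j (hUr j hj) hij]
  refine ⟨fun i => ((L.get i).toSymbolic ι).1, fun v => ((L.get v.1).toSymbolic ι).2 v.2.1 v.2.2,
    fun x => ?_⟩
  rw [amplitudePoly, symbolicRun_map]
  simp only [List.map_map, MvPolynomial.eval_C]
  have hlist : (List.finRange L.length).map ((fun g : ((Fin n ⊕ Fin (2 * L.length + 1)) ×
      (Fin n ⊕ Fin (2 * L.length + 1))) × (Bool → Bool →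
        MvPolynomial (Fin L.length × Bool × Bool) ℂ) => (g.1, fun a b => MvPolynomial.eval
        (fun v => ((L.get v.1).toSymbolic ι).2 v.2.1 v.2.2) (g.2 a b))) ∘
      fun i => (((L.get i).toSymbolic ι).1, fun a b => MvPolynomial.X (i, a, b))) =
      L.map (ElemGate.toSymbolic ι) := by
    have hget := congrArg (List.map (ElemGate.toSymbolic ι)) (List.map_get_finRange L)
    rw [List.map_map] at hget
    refine Eq.trans ?_ hget
    refine List.map_congr_left fun i _ => ?_
    simp only [Function.comp, MvPolynomial.eval_X]
  rw [hlist]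
  have hzero : ∀ p ∉ U.image ι, Sum.elim x (fun _ : Fin (2 * L.length + 1) => false) p = false := by
    rintro (i | j) hp
    · exact absurd (Finset.mem_image.2 ⟨Sum.inl i, hUl i, rfl⟩) hp
    · rfl
  rw [symbolicRun_toSymbolic ι U hι L Finset.subset_union_right (zeroState _) _ ?_ _ hzero]
  · rw [← h.run_sumElim, hrun]
    congr 1
    funext q
    rcases q with i | j
    · simp [hUl, ι]
    · simp [ι]
  · intro y hy
    simp only [zeroState]
    congr 1
    rw [eq_iff_iff]
    constructor
    · intro h q
      split_ifs <;> simp [h]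
    · intro h p
      by_cases hp : p ∈ U.image ι
      · obtain ⟨q, hq, rfl⟩ := Finset.mem_image.1 hp
        simpa [hq] using h q
      · exact hy p hp

end Symbolic

/-! ### Counting sparse states in the image of a polynomial map -/

section Counting

-- The monomials with all exponents at most `D` form a basis.
open MvPolynomial in
theorem finrank_restrictDegree_le {σ : Type} [Fintype σ] (D : ℕ) :
    Module.finrank ℂ (restrictDegree σ ℂ D) ≤ (D + 1) ^ Fintype.card σ := by
  classical
  have hb := Module.finrank_eq_nat_card_basis
    (basisRestrictSupport ℂ {n : σ →₀ ℕ | ∀ i, n i ≤ D})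
  change Module.finrank ℂ (restrictSupport ℂ {n : σ →₀ ℕ | ∀ i, n i ≤ D}) ≤ _
  rw [hb]
  have hinj : Function.Injective
      (fun (n : {n : σ →₀ ℕ | ∀ i, n i ≤ D}) (i : σ) =>
        (⟨n.1 i, Nat.lt_succ_of_le (n.2 i)⟩ : Fin (D + 1))) := by
    intro n n' h
    ext i
    simpa using congrFun h i
  refine (Nat.card_le_card_of_injective _ hinj).trans (le_of_eq ?_)
  rw [Nat.card_eq_fintype_card, Fintype.card_fun, Fintype.card_fin]

/-- The number of vectors with `d` non-zero entries, all entries lying in a set of `q + 1`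
numbers, in the image of a polynomial map. -/
theorem card_le_of_eval_eq {σ X : Type} [Fintype σ] [Fintype X] [DecidableEq X]
    (f : X → MvPolynomial σ ℂ) {s d q : ℕ} (hf : ∀ x v, (f x).degreeOf v ≤ s) (V : Finset ℂ)
    (hV : V.card ≤ q + 1) (W : Finset (X → ℂ)) (hWV : ∀ w ∈ W, ∀ x, w x ∈ V)
    (hWd : ∀ w ∈ W, {x | w x ≠ 0}.ncard = d)
    (hW : ∀ w ∈ W, ∃ u : σ → ℂ, ∀ x, MvPolynomial.eval u (f x) = w x) :
    W.card ≤ (d * (q * s) + 1) ^ Fintype.card σ := by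
  classical
  let supp : (X → ℂ) → Finset X := fun w => {x | w x ≠ 0}
  have hsupp : ∀ w ∈ W, (supp w).card = d := by
    intro w hw
    rw [← hWd w hw, ← Set.ncard_coe_finset]
    congr 1
    ext x
    simp [supp]
  choose! u hu using hW
  -- At the parameters of `w'`, this product vanishes exactly when `w'` differs from `w` somewhere
  -- on `supp w`. Since all supports have size `d`, agreement there forces `w' = w`. Restricting the
  -- product to the support keeps the degree independent of the number of strings.
  let g : (X → ℂ) → MvPolynomial σ ℂ := fun w =>
    ∏ x ∈ supp w, ∏ c ∈ V.erase (w x), (f x - MvPolynomial.C c)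
  have hgdeg : ∀ w ∈ W, g w ∈ MvPolynomial.restrictDegree σ ℂ (d * (q * s)) := by
    intro w hw
    rw [MvPolynomial.mem_restrictDegree]
    intro m hm v
    refine (MvPolynomial.degreeOf_le_iff.1 ?_) m hm
    refine (MvPolynomial.degreeOf_prod_le _ _ _).trans ?_
    rw [← hsupp w hw, ← smul_eq_mul]
    refine Finset.sum_le_card_nsmul _ _ _ fun x _ => ?_
    refine (MvPolynomial.degreeOf_prod_le _ _ _).trans ?_
    have hcard : (V.erase (w x)).card ≤ q := by
      rw [Finset.card_erase_of_mem (hWV w hw x)]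
      omega
    refine (Finset.sum_le_card_nsmul _ _ s fun c _ => ?_).trans
      (by rw [smul_eq_mul]; exact Nat.mul_le_mul_right s hcard)
    refine (MvPolynomial.degreeOf_sub_le _ _ _).trans (max_le (hf x v) ?_)
    rw [MvPolynomial.degreeOf_C]
    exact Nat.zero_le _
  have heval : ∀ w ∈ W, ∀ w' ∈ W, MvPolynomial.eval (u w') (g w) ≠ 0 ↔ w = w' := by
    intro w hw w' hw'
    simp only [g, map_prod, map_sub, MvPolynomial.eval_C, hu w' hw', Finset.prod_ne_zero_iff,
      sub_ne_zero, Finset.mem_erase]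
    constructor
    · intro h
      have h1 : ∀ x ∈ supp w, w' x = w x := by
        intro x hx
        by_contra hne
        exact h x hx (w' x) ⟨hne, hWV w' hw' x⟩ rfl
      have h2 : supp w = supp w' := by
        refine Finset.eq_of_subset_of_card_le (fun x hx => ?_)
          (by rw [hsupp w hw, hsupp w' hw'])
        have := h1 x hx
        simp only [supp, Finset.mem_filter, Finset.mem_univ, true_and] at hx ⊢
        rwa [this]
      funext x
      by_cases hx : x ∈ supp w
      · exact (h1 x hx).symm
      · have hx' := hx
        rw [h2] at hx'
        simp only [supp, Finset.mem_filter, Finset.mem_univ, true_and, not_not] at hx hx'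
        rw [hx, hx']
    · rintro rfl x _ c ⟨hc, -⟩ h
      exact hc h.symm
  -- Evaluating a linear relation at the parameters of `w` leaves only the coefficient of `g w`.
  have hli : LinearIndependent ℂ
      fun w : W => (⟨g w, hgdeg w w.2⟩ : MvPolynomial.restrictDegree σ ℂ (d * (q * s))) := by
    rw [Fintype.linearIndependent_iff]
    intro a ha w
    have h1 := congrArg (fun p : MvPolynomial.restrictDegree σ ℂ (d * (q * s)) =>
      MvPolynomial.eval (u w) (p : MvPolynomial σ ℂ)) ha
    simp only [Submodule.coe_sum, Submodule.coe_smul, map_sum, MvPolynomial.smul_eval,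
      Submodule.coe_zero, map_zero] at h1
    rw [Finset.sum_eq_single w] at h1
    · exact (mul_eq_zero.1 h1).resolve_right ((heval w w.2 w w.2).2 rfl)
    · intro w' _ hne
      have : ¬ MvPolynomial.eval (u w) (g w') ≠ 0 := fun h =>
        hne (Subtype.ext ((heval w' w'.2 w w.2).1 h))
      rw [not_not.1 this, mul_zero]
    · simp
  have := hli.fintype_card_le_finrank
  rw [Fintype.card_coe] at this
  exact this.trans (finrank_restrictDegree_le _)

/-- Factor by factor, `N * (d - i) ≤ (N - i) * d`. -/
theorem pow_le_choose_mul_pow {N d : ℕ} (hd : d ≤ N) : N ^ d ≤ N.choose d * d ^ d := by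
  have h : N ^ d * d.factorial ≤ N.descFactorial d * d ^ d := by
    rw [← Nat.descFactorial_self d, Nat.descFactorial_eq_prod_range,
      Nat.descFactorial_eq_prod_range]
    have e1 : N ^ d = ∏ _i ∈ Finset.range d, N := by simp
    have e2 : d ^ d = ∏ _i ∈ Finset.range d, d := by simp
    rw [e1, e2]
    rw [← Finset.prod_mul_distrib, ← Finset.prod_mul_distrib]
    refine Finset.prod_le_prod' fun i hi => ?_
    have hi := Finset.mem_range.1 hi
    rw [Nat.mul_sub, Nat.sub_mul]
    have : i * N ≥ i * d := Nat.mul_le_mul_left i hd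
    rw [Nat.mul_comm N i]
    omega
  rw [Nat.descFactorial_eq_factorial_mul_choose] at h
  refine Nat.le_of_mul_le_mul_right ?_ d.factorial_pos
  calc N ^ d * d.factorial ≤ _ := h
    _ = _ := by ring

/-- A large family of sparse states with few possible amplitudes. -/
theorem exists_sparse_family {n d : ℕ} (hd : 1 ≤ d) (hdn : d ≤ 2 ^ n) :
    ∃ (V : Finset ℂ) (W : Finset (QState (Fin n))), V.card ≤ d + 1 ∧
      (∀ w ∈ W, ∀ x, w x ∈ V) ∧ (∀ w ∈ W, IsSparseState d w) ∧ 2 ^ (n * d) ≤ W.card := by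
  classical
  have hd0 : d ≠ 0 := by omega
  let r : ℂ := ((√d : ℝ) : ℂ)⁻¹
  have hr : r ≠ 0 := by simp [r, hd0]
  have hrn : ‖r‖ ^ 2 = (d : ℝ)⁻¹ := by
    rw [norm_inv, inv_pow, Complex.norm_real, Real.norm_of_nonneg (Real.sqrt_nonneg _),
      Real.sq_sqrt (Nat.cast_nonneg d)]
  -- The `d`-th roots of unity scaled by `1 / √d`. Having `d` choices for each amplitude multiplies
  -- the number of supports by `d ^ d`, which compensates for `choose` being small when `d` is close
  -- to `2 ^ n`.
  let V₀ : Finset ℂ := (Polynomial.nthRootsFinset d (1 : ℂ)).image fun z => z * r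
  have hV₀ : V₀.card = d := by
    rw [Finset.card_image_of_injective _ (mul_left_injective₀ hr)]
    exact (Complex.isPrimitiveRoot_exp d hd0).card_nthRootsFinset
  have hV₀n : ∀ z ∈ V₀, ‖z‖ ^ 2 = (d : ℝ)⁻¹ := by
    intro z hz
    obtain ⟨y, hy, rfl⟩ := Finset.mem_image.1 hz
    have : y ^ d = 1 := (Polynomial.mem_nthRootsFinset (by omega) 1).1 hy
    rw [norm_mul, Complex.norm_eq_one_of_pow_eq_one this hd0, one_mul, hrn]
  have hV₀0 : ∀ z ∈ V₀, z ≠ 0 := by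
    intro z hz h
    have := hV₀n z hz
    rw [h] at this
    simp only [norm_zero, ne_eq, OfNat.ofNat_ne_zero, not_false_eq_true, zero_pow, zero_eq_inv] at this
    exact hd0 (by exact_mod_cast this.symm)
  let I : Finset (Σ S : Finset (Fin n → Bool), ∀ x ∈ S, ℂ) :=
    (Finset.powersetCard d Finset.univ).sigma fun S => S.pi fun _ => V₀
  let F : (Σ S : Finset (Fin n → Bool), ∀ x ∈ S, ℂ) → QState (Fin n) := fun p x =>
    if hx : x ∈ p.1 then p.2 x hx else 0
  have hF0 : ∀ p ∈ I, ∀ x, F p x ≠ 0 ↔ x ∈ p.1 := by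
    intro p hp x
    have hp2 := Finset.mem_pi.1 (Finset.mem_sigma.1 hp).2
    simp only [F]
    split_ifs with hx
    · simpa [hx] using hV₀0 _ (hp2 x hx)
    · simp [hx]
  have hFinj : Set.InjOn F I := by
    rintro ⟨S, a⟩ hp ⟨S', a'⟩ hp' h
    have hS : S = S' := by
      ext x
      rw [← hF0 _ hp x, ← hF0 _ hp' x, h]
    subst hS
    congr 1
    funext x hx
    have := congrFun h x
    simpa [F, hx] using this
  refine ⟨insert 0 V₀, I.image F, (Finset.card_insert_le _ _).trans (by rw [hV₀]), ?_, ?_, ?_⟩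
  · intro w hw x
    obtain ⟨p, hp, rfl⟩ := Finset.mem_image.1 hw
    have hp2 := Finset.mem_pi.1 (Finset.mem_sigma.1 hp).2
    simp only [F]
    split_ifs with hx
    · exact Finset.mem_insert_of_mem (hp2 x hx)
    · exact Finset.mem_insert_self _ _
  · intro w hw
    obtain ⟨p, hp, rfl⟩ := Finset.mem_image.1 hw
    have hp1 : p.1.card = d := (Finset.mem_powersetCard.1 (Finset.mem_sigma.1 hp).1).2
    have hp2 := Finset.mem_pi.1 (Finset.mem_sigma.1 hp).2
    constructor
    · have : ∀ x, ‖F p x‖ ^ 2 = if x ∈ p.1 then (d : ℝ)⁻¹ else 0 := by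
        intro x
        simp only [F]
        split_ifs with hx
        · exact hV₀n _ (hp2 x hx)
        · simp
      rw [Finset.sum_congr rfl fun x _ => this x, Finset.sum_ite_mem, Finset.univ_inter,
        Finset.sum_const, hp1, nsmul_eq_mul, mul_inv_cancel₀ (by exact_mod_cast hd0)]
    · rw [← hp1, ← Set.ncard_coe_finset]
      congr 1
      ext x
      exact hF0 p hp x
  · rw [Finset.card_image_of_injOn hFinj, Finset.card_sigma]
    have : ∀ S ∈ Finset.powersetCard d (Finset.univ : Finset (Fin n → Bool)),
        (S.pi fun _ => V₀).card = d ^ d := by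
      intro S hS
      rw [Finset.card_pi, Finset.prod_const, hV₀, (Finset.mem_powersetCard.1 hS).2]
    rw [Finset.sum_congr rfl this, Finset.sum_const, Finset.card_powersetCard, Finset.card_univ,
      smul_eq_mul, pow_mul]
    have hN : Fintype.card (Fin n → Bool) = 2 ^ n := by simp
    rw [hN]
    exact pow_le_choose_mul_pow hdn

/-- If all `d`-sparse states could be prepared by circuits of size `s`, there would be enough
circuits of this size. -/
theorem two_pow_le_of_prepares {n d s : ℕ} (hn : 1 ≤ n) (hd : 1 ≤ d) (hdn : d ≤ 2 ^ n)
    (h : ∀ ψ : QState (Fin n), IsSparseState d ψ →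
      ∃ (m : ℕ) (K : QCircuit (Fin n ⊕ Fin m)), Prepares K ψ ∧ K.length ≤ s) :
    2 ^ (n * d) ≤ (d * (d * s) + 1) ^ (4 * s) * (n + 2 * s + 1) ^ (2 * s) := by
  classical
  obtain ⟨V, W, hV, hWV, hWd, hW⟩ := exists_sparse_family hd hdn
  refine hW.trans ?_
  have H : ∀ w ∈ W, ∃ (τ : Fin s → (Fin n ⊕ Fin (2 * s + 1)) × (Fin n ⊕ Fin (2 * s + 1)))
      (u : Fin s × Bool × Bool → ℂ),
      ∀ x, MvPolynomial.eval u (amplitudePoly τ (Sum.elim x fun _ => false)) = w x := by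
    intro w hw
    obtain ⟨m, K, hK, hs⟩ := h w (hWd w hw)
    exact hK.exists_eval_amplitudePoly hn hs
  choose! τ hτ using H
  -- The family is sorted by gate placement. Each fibre is in the image of one polynomial map in `4
  -- * s` variables, with `q = d`.
  have hcard := Finset.card_le_mul_card_image (f := τ) W ((d * (d * s) + 1) ^ (4 * s))
    (fun a _ => by
      have := card_le_of_eval_eq (fun x => amplitudePoly a (Sum.elim x fun _ => false))
        (fun x v => degreeOf_amplitudePoly a _ v) V hV {w ∈ W | τ w = a}
        (fun w hw => hWV w (Finset.mem_filter.1 hw).1)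
        (fun w hw => (hWd w (Finset.mem_filter.1 hw).1).2)
        (fun w hw => by
          obtain ⟨hw', rfl⟩ := Finset.mem_filter.1 hw
          exact hτ w hw')
      refine this.trans (le_of_eq ?_)
      congr 1
      simp
      ring)
  refine hcard.trans (Nat.mul_le_mul_left _ ((Finset.card_le_univ _).trans (le_of_eq ?_)))
  simp only [Fintype.card_fun, Fintype.card_prod, Fintype.card_sum, Fintype.card_fin]
  rw [← pow_two, ← pow_mul, ← add_assoc]

end Counting

/-! ### Lower bounds on circuit size -/

section LowerBounds

theorem one_le_logb_two {x : ℝ} (hx : 2 ≤ x) : 1 ≤ Real.logb 2 x := by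
  rw [Real.le_logb_iff_rpow_le (by norm_num) (by linarith)]
  simpa using hx

theorem logb_two_le_self {n : ℕ} (hn : 1 ≤ n) : Real.logb 2 n ≤ n := by
  rw [Real.logb_le_iff_le_rpow (by norm_num) (by exact_mod_cast hn)]
  rw [Real.rpow_natCast]
  exact_mod_cast n.lt_two_pow_self.le

theorem logb_two_le_log {n : ℕ} (hn : 1 ≤ n) : Real.logb 2 n ≤ (Nat.log 2 n + 1 : ℕ) := by
  rw [Real.logb_le_iff_le_rpow (by norm_num) (by exact_mod_cast hn)]
  rw [Real.rpow_natCast]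
  exact_mod_cast (Nat.lt_pow_succ_log_self (by norm_num) n).le

theorem exists_sparse_counting_lower {n d : ℕ} (hn : 1 ≤ n) (hd : 1 ≤ d) (hdn : d ≤ 2 ^ n)
    (hnd : 2 ≤ n * d) :
    ∃ ψ : QState (Fin n), IsSparseState d ψ ∧
      ∀ (m : ℕ) (K : QCircuit (Fin n ⊕ Fin m)), Prepares K ψ →
        (n * d : ℝ) / Real.logb 2 (n * d : ℝ) / 23 ≤ (K.length : ℝ) := by
  have hN : (2 : ℝ) ≤ n * d := by exact_mod_cast hnd
  have hL := one_le_logb_two hN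
  by_contra! hcon
  -- With `N = n * d` and `s ≤ N`, the two bases of the count are at most `N ^ 4` and `N ^ 3`, so
  -- the exponent of `N` is `4 * 4 * s + 3 * 2 * s = 22 * s`. The constant 23 contradicts this.
  set β : ℝ := (n * d : ℝ) / Real.logb 2 (n * d : ℝ) / 23 with hβ
  have hβpos : 0 < β := by positivity
  have hβL : β * Real.logb 2 (n * d : ℝ) = n * d / 23 := by
    rw [hβ]
    field_simp
  have hβN : β ≤ n * d := by nlinarith
  have hceil : 0 < ⌈β⌉₊ := Nat.ceil_pos.2 hβpos
  have hsβ : ((⌈β⌉₊ - 1 : ℕ) : ℝ) < β := by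
    have := Nat.ceil_lt_add_one hβpos.le
    rw [Nat.cast_sub hceil]
    push_cast
    linarith
  -- The largest natural number below `β`, so any circuit shorter than `β` has at most this size.
  have key := two_pow_le_of_prepares (s := ⌈β⌉₊ - 1) hn hd hdn fun ψ hψ => by
    obtain ⟨m, K, hK, hlt⟩ := hcon ψ hψ
    have := Nat.lt_ceil.2 hlt
    exact ⟨m, K, hK, by omega⟩
  generalize ⌈β⌉₊ - 1 = s at key hsβ
  have hsN : s ≤ n * d := by exact_mod_cast (hsβ.le.trans hβN)
  have hdN : d ≤ n * d := Nat.le_mul_of_pos_left d hn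
  have hnN : n ≤ n * d := Nat.le_mul_of_pos_right n hd
  have hreal : (n * d : ℝ) ≤ 22 * s * Real.logb 2 (n * d : ℝ) := by
    have hcast : ((n * d : ℕ) : ℝ) = n * d := by push_cast; ring
    rw [← hcast]
    generalize n * d = N at *
    have h1 : d * (d * s) + 1 ≤ N ^ 4 := by
      have : d * (d * s) ≤ N * (N * N) := Nat.mul_le_mul hdN (Nat.mul_le_mul hdN hsN)
      have h3 : 0 < N ^ 3 := Nat.pow_pos (by omega)
      calc d * (d * s) + 1 ≤ N ^ 3 + N ^ 3 := by
            have : N * (N * N) = N ^ 3 := by ring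
            omega
        _ = N ^ 3 * 2 := by ring
        _ ≤ N ^ 3 * N := Nat.mul_le_mul_left _ hnd
        _ = N ^ 4 := by ring
    have h2 : n + 2 * s + 1 ≤ N ^ 3 := by nlinarith [Nat.mul_le_mul hnd hnd]
    have h3 : 2 ^ N ≤ N ^ (22 * s) := by
      refine key.trans ((Nat.mul_le_mul (Nat.pow_le_pow_left h1 _)
        (Nat.pow_le_pow_left h2 _)).trans (le_of_eq ?_))
      rw [← pow_mul, ← pow_mul, ← pow_add]
      congr 1
      ring
    have h4 : (2 : ℝ) ^ N ≤ (N : ℝ) ^ (22 * s) := by exact_mod_cast h3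
    have h5 := Real.logb_le_logb_of_le (b := 2) (by norm_num) (by positivity) h4
    rw [Real.logb_pow, Real.logb_pow, Real.logb_self_eq_one (by norm_num), mul_one] at h5
    push_cast at h5
    exact h5
  have : (s : ℝ) * Real.logb 2 (n * d : ℝ) ≤ n * d / 23 := by
    rw [← hβL]
    exact mul_le_mul_of_nonneg_right hsβ.le (by linarith)
  linarith

theorem exists_sparse_touching {n d : ℕ} (hd : 1 ≤ d) (hdn : d ≤ 2 ^ n) :
    ∃ ψ : QState (Fin n), IsSparseState d ψ ∧ ψ (fun _ => true) ≠ 0 := by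
  have hd0 : (d : ℝ) ≠ 0 := by
    have : d ≠ 0 := by omega
    exact_mod_cast this
  obtain ⟨S, hS, hcard⟩ := Finset.exists_superset_card_eq
    (s := {fun _ : Fin n => true}) (n := d) (by simpa using hd) (by simpa using hdn)
  have hr : ((√(d : ℝ) : ℝ) : ℂ)⁻¹ ≠ 0 := by
    rw [ne_eq, inv_eq_zero, Complex.ofReal_eq_zero, Real.sqrt_eq_zero (Nat.cast_nonneg d)]
    exact hd0
  refine ⟨fun x => if x ∈ S then ((√(d : ℝ) : ℝ) : ℂ)⁻¹ else 0, ⟨?_, ?_⟩, ?_⟩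
  · have : ∀ x, ‖(if x ∈ S then ((√(d : ℝ) : ℝ) : ℂ)⁻¹ else 0 : ℂ)‖ ^ 2 =
        if x ∈ S then (d : ℝ)⁻¹ else 0 := by
      intro x
      split_ifs
      · rw [norm_inv, inv_pow, Complex.norm_real, Real.norm_of_nonneg (Real.sqrt_nonneg _),
          Real.sq_sqrt (Nat.cast_nonneg d)]
      · simp
    rw [Finset.sum_congr rfl fun x _ => this x, Finset.sum_ite_mem, Finset.univ_inter,
      Finset.sum_const, hcard, nsmul_eq_mul, mul_inv_cancel₀ hd0]
  · refine (Eq.trans ?_ (Set.ncard_coe_finset S)).trans hcard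
    congr 1
    ext x
    simp only [Set.mem_ofPred_eq, Finset.mem_coe]
    split_ifs with h
    · exact ⟨fun _ => h, fun _ => hr⟩
    · simp [h]
  · simp only [Finset.singleton_subset_iff] at hS
    simpa [hS] using hr

/-- The lower bound for the preparation of sparse states with ancillary qubits. -/
theorem exists_sparse_lower {n d : ℕ} (hn : 1 ≤ n) (hd : 1 ≤ d) (hdn : d ≤ 2 ^ n)
    (hnd : 2 ≤ n * d) :
    ∃ ψ : QState (Fin n), IsSparseState d ψ ∧
      ∀ (m : ℕ) (K : QCircuit (Fin n ⊕ Fin m)), Prepares K ψ →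
        1 / 46 * ((n * d : ℝ) / Real.logb 2 (n * d : ℝ) + n) ≤ (K.length : ℝ) := by
  -- The larger of the two terms is at least half of their sum, hence `46 = 2 * 23`.
  rcases le_total (n : ℝ) ((n * d : ℝ) / Real.logb 2 (n * d : ℝ)) with h | h
  · obtain ⟨ψ, hψ, H⟩ := exists_sparse_counting_lower hn hd hdn hnd
    refine ⟨ψ, hψ, fun m K hK => ?_⟩
    have := H m K hK
    linarith
  · obtain ⟨ψ, hψ, h1⟩ := exists_sparse_touching hd hdn
    refine ⟨ψ, hψ, fun m K hK => ?_⟩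
    have h2 : (n : ℝ) ≤ 2 * (K.length : ℝ) := by exact_mod_cast hK.le_two_mul_size h1
    have h3 : (0 : ℝ) ≤ n := Nat.cast_nonneg n
    linarith

end LowerBounds

/-! ### Upper bounds on circuit size -/

section UpperBounds

theorem two_pow_clog_le {d : ℕ} (hd : 1 ≤ d) : 2 ^ Nat.clog 2 d ≤ 2 * d := by
  rcases Nat.eq_or_lt_of_le hd with rfl | hd
  · simp
  · have h1 := Nat.pow_pred_clog_lt_self (b := 2) (by norm_num) hd
    have h2 : 0 < Nat.clog 2 d := Nat.clog_pos (by norm_num) hd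
    have h3 : 2 ^ Nat.clog 2 d = 2 * 2 ^ (Nat.clog 2 d).pred := by
      rw [← pow_succ', Nat.pred_eq_sub_one, Nat.sub_add_cancel h2]
    omega

theorem exists_prepares_dense {n d : ℕ} (hn : 1 ≤ n) (ψ : QState (Fin n))
    (hψ : IsSparseState d ψ) :
    ∃ K : QCircuit (Fin n ⊕ Fin 0), Prepares K ψ ∧ K.length ≤ 6 * 2 ^ n := by
  have : Nonempty (Fin n) := ⟨⟨0, hn⟩⟩
  obtain ⟨K, hK, hlen⟩ := exists_circuit_of_state ψ hψ.1
  obtain ⟨K', hK', hlen'⟩ := exists_prepares_zero K hK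
  exact ⟨K', hK', by rw [hlen']; simpa using hlen⟩

/-- The space condition for batches of size `t = (log n) / 8`. The term `4 ^ t` is at most about `n
^ (1 / 4)` and the others are `O(log n)`; each group is bounded by half of `2 ^ l`, where `2 ^ l ≤
n`. -/
theorem card_condition {A k n d : ℕ} (hd : 1 ≤ d) (hdA : d ≤ 2 ^ A * n ^ k)
    (hn : 2 ^ (2 * (A + k + 5) + 8) ≤ n) :
    Nat.clog 2 d + 4 ^ (Nat.log 2 n / 8) + Nat.log 2 n / 8 + 3 ≤ n := by
  have hn0 : n ≠ 0 := by
    have : 0 < 2 ^ (2 * (A + k + 5) + 8) := by positivity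
    omega
  set l := Nat.log 2 n with hl
  have hl1 : 2 * (A + k + 5) + 8 ≤ l := Nat.le_log_of_pow_le (by norm_num) hn
  have hl2 : 2 ^ l ≤ n := Nat.pow_log_le_self 2 hn0
  have hl3 : n ≤ 2 ^ (l + 1) := (Nat.lt_pow_succ_log_self (by norm_num) n).le
  have hr : Nat.clog 2 d ≤ 1 + A + (l + 1) * k := by
    rw [← Nat.pow_le_pow_iff_right (a := 2) (by norm_num)]
    calc 2 ^ Nat.clog 2 d ≤ 2 * (2 ^ A * n ^ k) :=
          (two_pow_clog_le hd).trans (Nat.mul_le_mul_left 2 hdA)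
      _ ≤ 2 * (2 ^ A * (2 ^ (l + 1)) ^ k) :=
          Nat.mul_le_mul_left 2 (Nat.mul_le_mul_left _ (Nat.pow_le_pow_left hl3 k))
      _ = 2 ^ (1 + A + (l + 1) * k) := by rw [← pow_mul, pow_add, pow_add, pow_one, mul_assoc]
  have h4 : 4 ^ (l / 8) ≤ 2 ^ (l - 1) := by
    rw [show (4 : ℕ) = 2 ^ 2 by norm_num, ← pow_mul]
    exact Nat.pow_le_pow_right (by norm_num) (by omega)
  have hc : A + k + 5 ≤ 2 ^ (l / 2 - 2) :=
    (Nat.lt_two_pow_self (n := A + k + 5)).le.trans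
      (Nat.pow_le_pow_right (by norm_num) (by omega))
  have hl4 : l + 1 ≤ 2 ^ (l / 2 + 1) := by
    have := Nat.lt_two_pow_self (n := l / 2)
    rw [pow_succ]
    omega
  have hprod : (l + 1) * (A + k + 5) ≤ 2 ^ (l - 1) := by
    refine (Nat.mul_le_mul hl4 hc).trans ?_
    rw [← pow_add]
    exact Nat.pow_le_pow_right (by norm_num) (by omega)
  have hsum : 2 ^ (l - 1) + 2 ^ (l - 1) = 2 ^ l := by
    rw [← two_mul, ← pow_succ', Nat.sub_add_cancel (by omega)]
  have hle : 1 + A + (l + 1) * k + l / 8 + 3 ≤ (l + 1) * (A + k + 5) := by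
    have : A ≤ (l + 1) * A := Nat.le_mul_of_pos_left A (by omega)
    rw [mul_add, mul_add]
    omega
  omega

/-- Sparse states of polynomially bounded sparsity, prepared without ancillary qubits. -/
theorem exists_prepares_without_ancillas (a : ℝ) (k : ℕ) : ∃ C : ℝ, 0 < C ∧
    ∀ n d : ℕ, 2 ≤ n → 1 ≤ d → d ≤ 2 ^ n → (d : ℝ) ≤ a * (n : ℝ) ^ k →
      ∀ ψ : QState (Fin n), IsSparseState d ψ →
        ∃ K : QCircuit (Fin n ⊕ Fin 0), Prepares K ψ ∧
          (K.length : ℝ) ≤ C * ((n * d : ℝ) / Real.logb 2 (n : ℝ) + n) := by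
  obtain ⟨A, hA⟩ := pow_unbounded_of_one_lt a (show (1 : ℝ) < 2 by norm_num)
  obtain ⟨n₀, hn₀⟩ : ∃ n₀, ∀ n, n₀ ≤ n → 2 ^ (2 * (A + k + 5) + 8) ≤ n := ⟨_, fun _ => id⟩
  -- The summand `6 * 2 ^ n₀` pays for dense preparation when `n < n₀`.
  refine ⟨400000 + 6 * 2 ^ n₀, by positivity, fun n d hn hd hdn hda ψ hψ => ?_⟩
  have hnR : (2 : ℝ) ≤ n := by exact_mod_cast hn
  have hL := one_le_logb_two hnR
  set L := Real.logb 2 (n : ℝ) with hLdef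
  have hq : (0 : ℝ) ≤ (n * d : ℝ) / L := by positivity
  rcases lt_or_ge n n₀ with hsmall | hlarge
  · obtain ⟨K, hK, hlen⟩ := exists_prepares_dense (by omega) ψ hψ
    refine ⟨K, hK, ?_⟩
    have h1 : K.length ≤ 6 * 2 ^ n₀ :=
      hlen.trans (Nat.mul_le_mul_left 6 (Nat.pow_le_pow_right (by norm_num) hsmall.le))
    have h2 : (K.length : ℝ) ≤ 6 * 2 ^ n₀ := by exact_mod_cast h1
    have h3 : (0 : ℝ) ≤ 6 * 2 ^ n₀ := by positivity
    have h4 := mul_le_mul (show 6 * 2 ^ n₀ ≤ 400000 + 6 * (2 : ℝ) ^ n₀ by linarith)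
      (show 1 ≤ (n * d : ℝ) / L + n by linarith) zero_le_one (by linarith)
    linarith
  have hdA : d ≤ 2 ^ A * n ^ k := by
    have : (d : ℝ) ≤ 2 ^ A * (n : ℝ) ^ k :=
      hda.trans (mul_le_mul_of_nonneg_right hA.le (by positivity))
    exact_mod_cast this
  have hcond := card_condition hd hdA (hn₀ n hlarge)
  have hl8 : 8 ≤ Nat.log 2 n := Nat.le_log_of_pow_le (by norm_num)
    (le_trans (Nat.pow_le_pow_right (by norm_num) (by omega)) (hn₀ n hlarge))
  have hl : 2 ^ Nat.log 2 n ≤ n := Nat.pow_log_le_self 2 (by omega)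
  have hLl : L ≤ (Nat.log 2 n + 1 : ℕ) := logb_two_le_log (by omega)
  generalize Nat.log 2 n = l at hcond hl8 hl hLl
  set t := l / 8 with ht
  have ht1 : 1 ≤ t := by omega
  have hr := Nat.le_pow_clog (b := 2) (by norm_num) d
  obtain ⟨K, hK, hlen⟩ := exists_circuit_of_sparse ψ d hψ hr ht1 (by simpa using hcond)
  obtain ⟨K', hK', hlen'⟩ := exists_prepares_zero K hK
  refine ⟨K', hK', ?_⟩
  rw [hlen']
  -- With `t = l / 8`, even `16 ^ t` is at most `n`, so the permutation part of a batch is also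
  -- linear in `n`.
  have hbatch : 1402 * n + 6000 * (t * (4 ^ t + 2)) ≤ 20000 * n := by
    have h1 : t ≤ 4 ^ t := (Nat.lt_pow_self (by norm_num)).le
    have h2 : 4 ^ t * 4 ^ t ≤ n := by
      refine le_trans ?_ hl
      rw [show (4 : ℕ) = 2 ^ 2 by norm_num, ← pow_mul, ← pow_add]
      exact Nat.pow_le_pow_right (by norm_num) (by omega)
    have h3 : t * (4 ^ t + 2) ≤ 4 ^ t * (3 * 4 ^ t) := Nat.mul_le_mul h1 (by omega)
    rw [mul_left_comm] at h3
    generalize t * (4 ^ t + 2) = w at *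
    generalize 4 ^ t * 4 ^ t = w' at *
    omega
  have hlen2 : K.length ≤ 12 * d + (d + t - 1) / t * (20000 * n) := by
    have h1 := two_pow_clog_le hd
    rw [Fintype.card_fin] at hlen
    have h2 := Nat.mul_le_mul_left ((d + t - 1) / t) hbatch
    omega
  have hdiv : (((d + t - 1) / t : ℕ) : ℝ) ≤ 16 * d / L + 1 := by
    have h1 : (((d + t - 1) / t : ℕ) : ℝ) ≤ ((d + t - 1 : ℕ) : ℝ) / t := Nat.cast_div_le
    have h2 : ((d + t - 1 : ℕ) : ℝ) ≤ d + t := by exact_mod_cast Nat.sub_le _ _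
    have htR : (0 : ℝ) < t := by exact_mod_cast ht1
    have h3 : ((d + t - 1 : ℕ) : ℝ) / t ≤ d / t + 1 := by
      rw [div_add_one htR.ne']
      exact div_le_div_of_nonneg_right h2 htR.le
    have h4 : L ≤ 16 * t := by
      refine hLl.trans ?_
      exact_mod_cast (show l + 1 ≤ 16 * t by omega)
    have h5 : (d : ℝ) / t ≤ 16 * d / L := by
      rw [div_le_div_iff₀ htR (by linarith)]
      have : (d : ℝ) * L ≤ d * (16 * t) := mul_le_mul_of_nonneg_left h4 (Nat.cast_nonneg d)
      linarith
    linarith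
  have hlen3 : (K.length : ℝ) ≤ 12 * d + (((d + t - 1) / t : ℕ) : ℝ) * (20000 * n) := by
    exact_mod_cast hlen2
  have hd12 : (d : ℝ) ≤ n * d / L := by
    rw [le_div_iff₀ (by linarith)]
    have : L ≤ n := logb_two_le_self (by omega)
    have := mul_le_mul_of_nonneg_right this (Nat.cast_nonneg (α := ℝ) d)
    linarith
  have hmul : (((d + t - 1) / t : ℕ) : ℝ) * (20000 * n) ≤
      (16 * d / L + 1) * (20000 * n) := mul_le_mul_of_nonneg_right hdiv (by positivity)
  have heq : (16 * d / L + 1) * (20000 * n) = 320000 * (n * d / L) + 20000 * (n : ℝ) := by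
    field_simp
    ring
  have hC : (0 : ℝ) ≤ 6 * 2 ^ n₀ * (n * d / L + n) := by positivity
  rw [add_mul]
  linarith

/-- Sparse states of large sparsity, prepared with ancillary qubits. -/
theorem exists_prepares_of_lt {n d : ℕ} (hdn : d ≤ 2 ^ n)
    (h4 : 4 ≤ d) (ψ : QState (Fin n)) (hψ : IsSparseState d ψ) :
    ∃ (m : ℕ) (K : QCircuit (Fin n ⊕ Fin m)), Prepares K ψ ∧
      K.length * (Nat.log 2 d + 1) ≤ 100000 * (n * d) := by
  have hl2 : 2 ≤ Nat.log 2 d := Nat.le_log_of_pow_le (by norm_num) (by omega)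
  have hld : 2 ^ Nat.log 2 d ≤ d := Nat.pow_log_le_self 2 (by omega)
  have hln : Nat.log 2 d ≤ n := (Nat.pow_le_pow_iff_right (a := 2) (by norm_num)).1
    (hld.trans hdn)
  generalize Nat.log 2 d = l at hl2 hld hln
  -- Half of `log d` balances the costs: `2 ^ t ≤ √d` keeps the encoding cheap, while the number of
  -- blocks is still `O(n / log d)`.
  set t := l / 2 with ht
  have ht1 : 1 ≤ t := by omega
  have hB := Nat.lt_mul_div_succ n (show 0 < t by omega)
  have hBt : (n / t + 1) * t ≤ 2 * n := by
    have := Nat.div_mul_le_self n t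
    calc (n / t + 1) * t = n / t * t + t := by ring
      _ ≤ 2 * n := by omega
  have hB1 : 1 ≤ n / t + 1 := Nat.le_add_left 1 _
  rw [mul_comm] at hB
  generalize n / t + 1 = B at hB hBt hB1
  have hrn : Nat.clog 2 d ≤ n := (Nat.clog_le_iff_le_pow (by norm_num)).2 hdn
  obtain ⟨m, K, hK, hlen⟩ := exists_prepares_of_blocks ψ hψ ht1 hB.le
    (Nat.le_pow_clog (b := 2) (by norm_num) d) (hrn.trans hB.le)
  refine ⟨m, K, hK, ?_⟩
  have hclog := two_pow_clog_le (show 1 ≤ d by omega)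
  have h2t : 2 ^ t * 2 ^ t ≤ d := by
    refine le_trans ?_ hld
    rw [← pow_add]
    exact Nat.pow_le_pow_right (by norm_num) (by omega)
  have htp : t ≤ 2 ^ t := Nat.lt_two_pow_self.le
  generalize 2 ^ t = p at *
  have hlen2 : K.length ≤ 12 * d + 5604 * (n * p) + 9000 * (d * B) := by
    have h1 : B * t * p ≤ 2 * n * p := Nat.mul_le_mul_right p hBt
    have h2 : B * p * (700 * (t + 1)) ≤ 1400 * (B * t * p) := by
      calc B * p * (700 * (t + 1)) ≤ B * p * (700 * (2 * t)) :=
            Nat.mul_le_mul_left _ (by omega)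
        _ = 1400 * (B * t * p) := by ring
    have h3 : d * (3000 * (2 * B + 1)) ≤ 9000 * (d * B) := by
      calc d * (3000 * (2 * B + 1)) ≤ d * (3000 * (3 * B)) := Nat.mul_le_mul_left _ (by omega)
        _ = 9000 * (d * B) := by ring
    rw [mul_assoc 2 n p] at h1
    omega
  have e1 : d * (l + 1) ≤ 2 * (n * d) := by
    calc d * (l + 1) ≤ d * (2 * n) := Nat.mul_le_mul_left d (by omega)
      _ = 2 * (n * d) := by ring
  have e2 : n * p * (l + 1) ≤ 4 * (n * d) := by
    calc n * p * (l + 1) ≤ n * p * (4 * p) := Nat.mul_le_mul_left _ (by omega)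
      _ = 4 * (n * (p * p)) := by ring
      _ ≤ 4 * (n * d) := Nat.mul_le_mul_left 4 (Nat.mul_le_mul_left n h2t)
  have e3 : d * B * (l + 1) ≤ 8 * (n * d) := by
    calc d * B * (l + 1) ≤ d * B * (4 * t) := Nat.mul_le_mul_left _ (by omega)
      _ = 4 * d * (B * t) := by ring
      _ ≤ 4 * d * (2 * n) := Nat.mul_le_mul_left _ hBt
      _ = 8 * (n * d) := by ring
  calc K.length * (l + 1) ≤ (12 * d + 5604 * (n * p) + 9000 * (d * B)) * (l + 1) :=
        Nat.mul_le_mul_right _ hlen2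
    _ = 12 * (d * (l + 1)) + 5604 * (n * p * (l + 1)) + 9000 * (d * B * (l + 1)) := by ring
    _ ≤ 100000 * (n * d) := by omega

/-- The upper bound for the preparation of sparse states with ancillary qubits. -/
theorem exists_prepares_with_ancillas : ∃ C : ℝ, 0 < C ∧
    ∀ n d : ℕ, 1 ≤ n → 1 ≤ d → d ≤ 2 ^ n → 2 ≤ n * d →
      ∀ ψ : QState (Fin n), IsSparseState d ψ →
        ∃ (m : ℕ) (K : QCircuit (Fin n ⊕ Fin m)), Prepares K ψ ∧
          (K.length : ℝ) ≤ C * ((n * d : ℝ) / Real.logb 2 (n * d : ℝ) + n) := by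
  obtain ⟨C, hC, H⟩ := exists_prepares_without_ancillas 1 1
  refine ⟨2 * C + 200000, by positivity, fun n d hn hd hdn hnd ψ hψ => ?_⟩
  have hN : (2 : ℝ) ≤ n * d := by exact_mod_cast hnd
  have hL := one_le_logb_two hN
  have hdR : (1 : ℝ) ≤ d := by exact_mod_cast hd
  have hnR : (1 : ℝ) ≤ n := by exact_mod_cast hn
  have hlog : Real.logb 2 (n * d : ℝ) = Real.logb 2 n + Real.logb 2 d :=
    Real.logb_mul (by positivity) (by positivity)
  set L := Real.logb 2 (n * d : ℝ) with hLdef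
  have hq : (0 : ℝ) ≤ (n * d : ℝ) / L := by positivity
  -- If `d ≤ n`, then `log (n * d) ≤ 2 * log n` and batches suffice without ancillas; if `d > n`,
  -- then `log (n * d) ≤ 2 * log d` and the block code applies once `d ≥ 4`.
  rcases le_or_gt d n with hdle | hlt
  · have hn2 : 2 ≤ n := by
      by_contra h
      have : n = 1 := by omega
      subst this
      omega
    obtain ⟨K, hK, hlen⟩ := H n d hn2 hd hdn (by simpa using hdle) ψ hψ
    refine ⟨0, K, hK, hlen.trans ?_⟩
    have hLn : L ≤ 2 * Real.logb 2 n := by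
      have : Real.logb 2 d ≤ Real.logb 2 n :=
        Real.logb_le_logb_of_le (by norm_num) (by linarith) (by exact_mod_cast hdle)
      linarith
    have h1 : (n * d : ℝ) / Real.logb 2 n ≤ 2 * ((n * d : ℝ) / L) := by
      rw [← mul_div_assoc, div_le_div_iff₀ (by linarith) (by linarith)]
      have := mul_le_mul_of_nonneg_left hLn (show (0 : ℝ) ≤ n * d by positivity)
      linarith
    have h2 : C * ((n * d : ℝ) / Real.logb 2 n + n) ≤ C * (2 * ((n * d : ℝ) / L + n)) :=
      mul_le_mul_of_nonneg_left (by linarith) hC.le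
    linarith
  · rcases lt_or_ge d 4 with hd4 | hd4
    · obtain ⟨K, hK, hlen⟩ := exists_prepares_dense hn ψ hψ
      refine ⟨0, K, hK, ?_⟩
      have h1 : K.length ≤ 6 * 2 ^ 3 :=
        hlen.trans (Nat.mul_le_mul_left 6 (Nat.pow_le_pow_right (by norm_num) (by omega)))
      have h2 : (K.length : ℝ) ≤ 6 * 2 ^ 3 := by exact_mod_cast h1
      have h3 : 200000 * 1 ≤ (2 * C + 200000) * ((n * d : ℝ) / L + n) :=
        mul_le_mul (by linarith) (by linarith) (by norm_num) (by linarith)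
      linarith
    · obtain ⟨m, K, hK, hlen⟩ := exists_prepares_of_lt hdn hd4 ψ hψ
      refine ⟨m, K, hK, ?_⟩
      have h1 : L ≤ 2 * (Nat.log 2 d + 1 : ℕ) := by
        have h2 : Real.logb 2 n ≤ Real.logb 2 d :=
          Real.logb_le_logb_of_le (by norm_num) (by linarith) (by exact_mod_cast hlt.le)
        have h3 := logb_two_le_log hd
        linarith
      have h2 : (K.length : ℝ) * (Nat.log 2 d + 1 : ℕ) ≤ 100000 * (n * d) := by
        exact_mod_cast hlen
      have h3 : (K.length : ℝ) * L ≤ 200000 * (n * d) := by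
        have := mul_le_mul_of_nonneg_left h1 (Nat.cast_nonneg (α := ℝ) K.length)
        linarith
      have h4 : (K.length : ℝ) ≤ 200000 * ((n * d : ℝ) / L) := by
        rw [← mul_div_assoc, le_div_iff₀ (by linarith)]
        exact h3
      have h5 : 0 ≤ 2 * C * ((n * d : ℝ) / L + n) := by positivity
      rw [add_mul]
      linarith

end UpperBounds

theorem theorem7 :
    -- unlimited number of ancillary qubits
    (∃ c C : ℝ, 0 < c ∧ 0 < C ∧
      ∀ n d : ℕ, 1 ≤ n → 1 ≤ d → d ≤ 2 ^ n → 2 ≤ n * d →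
        (∀ ψ : QState (Fin n), IsSparseState d ψ →
          ∃ (m : ℕ) (K : QCircuit (Fin n ⊕ Fin m)), Prepares K ψ ∧
            (K.size : ℝ) ≤ C * ((n * d : ℝ) / Real.logb 2 (n * d : ℝ) + n)) ∧
        (∃ ψ : QState (Fin n), IsSparseState d ψ ∧
          ∀ (m : ℕ) (K : QCircuit (Fin n ⊕ Fin m)), Prepares K ψ →
            c * ((n * d : ℝ) / Real.logb 2 (n * d : ℝ) + n) ≤ (K.size : ℝ))) ∧
    -- polynomially bounded sparsity: the upper bound needs no ancillary qubit, and the lower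
    -- bound holds for any number of them
    (∀ (a : ℝ) (k : ℕ), ∃ c C : ℝ, 0 < c ∧ 0 < C ∧
      ∀ n d : ℕ, 2 ≤ n → 1 ≤ d → d ≤ 2 ^ n → (d : ℝ) ≤ a * (n : ℝ) ^ k →
        (∀ ψ : QState (Fin n), IsSparseState d ψ →
          ∃ K : QCircuit (Fin n ⊕ Fin 0), Prepares K ψ ∧
            (K.size : ℝ) ≤ C * ((n * d : ℝ) / Real.logb 2 (n : ℝ) + n)) ∧
        (∃ ψ : QState (Fin n), IsSparseState d ψ ∧
          ∀ (m : ℕ) (K : QCircuit (Fin n ⊕ Fin m)), Prepares K ψ →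
            c * ((n * d : ℝ) / Real.logb 2 (n : ℝ) + n) ≤ (K.size : ℝ))) := by
  refine ⟨?_, fun a k => ?_⟩
  · obtain ⟨C, hC, H⟩ := exists_prepares_with_ancillas
    exact ⟨1 / 46, C, by norm_num, hC, fun n d hn hd hdn hnd =>
      ⟨H n d hn hd hdn hnd, exists_sparse_lower hn hd hdn hnd⟩⟩
  · obtain ⟨C, hC, H⟩ := exists_prepares_without_ancillas a k
    obtain ⟨A, hA⟩ := pow_unbounded_of_one_lt a (show (1 : ℝ) < 2 by norm_num)
    -- Since `a < 2 ^ A ≤ n ^ A`, one has `n * d ≤ n ^ (A + k + 1)`; replacing `log (n * d)` by `log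
    -- n` costs a factor `A + k + 1`.
    refine ⟨1 / (46 * (A + k + 1)), C, by positivity, hC, fun n d hn hd hdn hda =>
      ⟨H n d hn hd hdn hda, ?_⟩⟩
    have hnd : 2 ≤ n * d := by nlinarith
    obtain ⟨ψ, hψ, hlow⟩ := exists_sparse_lower (by omega) hd hdn hnd
    refine ⟨ψ, hψ, fun m K hK => le_trans ?_ (hlow m K hK)⟩
    have hnR : (2 : ℝ) ≤ n := by exact_mod_cast hn
    have hLn := one_le_logb_two hnR
    have hL := one_le_logb_two (show (2 : ℝ) ≤ n * d by exact_mod_cast hnd)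
    have hle : (n * d : ℝ) ≤ (n : ℝ) ^ (A + k + 1) := by
      have h1 : (d : ℝ) ≤ 2 ^ A * (n : ℝ) ^ k :=
        hda.trans (mul_le_mul_of_nonneg_right hA.le (by positivity))
      have h2 : (2 : ℝ) ^ A ≤ (n : ℝ) ^ A := pow_le_pow_left₀ (by norm_num) hnR A
      calc (n * d : ℝ) ≤ n * ((n : ℝ) ^ A * (n : ℝ) ^ k) :=
            mul_le_mul_of_nonneg_left
              (h1.trans (mul_le_mul_of_nonneg_right h2 (by positivity))) (by positivity)
        _ = (n : ℝ) ^ (A + k + 1) := by rw [pow_succ, pow_add]; ring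
    have hlog : Real.logb 2 (n * d : ℝ) ≤ (A + k + 1) * Real.logb 2 n := by
      have h1 := Real.logb_le_logb_of_le (b := 2) (by norm_num)
        (show (0 : ℝ) < n * d by linarith [show (2 : ℝ) ≤ n * d by exact_mod_cast hnd]) hle
      rw [Real.logb_pow] at h1
      push_cast at h1
      exact h1
    have hM : (1 : ℝ) ≤ A + k + 1 := by
      have h1 := Nat.cast_nonneg (α := ℝ) A
      have h2 := Nat.cast_nonneg (α := ℝ) k
      linarith
    have h1 : (n * d : ℝ) / Real.logb 2 n ≤
        (A + k + 1) * ((n * d : ℝ) / Real.logb 2 (n * d : ℝ)) := by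
      rw [← mul_div_assoc, div_le_div_iff₀ (by linarith) (by linarith)]
      have := mul_le_mul_of_nonneg_left hlog (show (0 : ℝ) ≤ n * d by positivity)
      linarith
    have h2 : (n : ℝ) ≤ (A + k + 1) * n := le_mul_of_one_le_left (by linarith) hM
    rw [div_mul_eq_mul_div, one_mul, div_le_iff₀ (by positivity)]
    linarith
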